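/- Let $\sigma,\gamma,h>0$ and $H\in(\tfrac12,1)$. For $i=1,2,\dots$ let $B^i$ be a standard Brownian motion and $B^{H,i}$ an independent fractional Brownian motion with Hurst index $H$ on $[0,\infty)$, and put $M^i_t=\sigma B^i_t+\gamma B^{H,i}_t$; the processes $M^1,M^2,\dots$ are mutually independent. Let $\phi_1,\phi_2,\dots$ be i.i.d. random variables, independent of the sequence $(M^i)_i$, with values in $[-1,1]$, distribution function $F$ and density $f$. Let $$X^i_t=\exp\{(\phi_i-\tfrac12\sigma^2)t+M^i_t\},\qquad Y^i_t=\log X^i_t ,$$ that is, $X^i$ is the solution of $dX^i_t=\phi_iX^i_t\,dt+X^i_t\,dM^i_t$, $X^i_0=1$. With $\Delta Y^i_k=Y^i_{(k+1)h}-Y^i_{kh}$ define $$\xi^i_n=\frac1n\sum_{k=0}^{n-1}(\Delta Y^i_k)^2,\quad \eta^i_n=\frac1n\sum_{k=0}^{n-1}\Delta Y^i_k\,\Delta Y^i_{k+1},\quad \zeta^i_n=\frac1n\sum_{k=0}^{n-1}(Y^i_{(k+2)h}-Y^i_{kh})(Y^i_{(k+4)h}-Y^i_{(k+2)h}),\quad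 \hat\theta_i=\frac1{nh}\sum_{k=0}^{n-1}\Delta Y^i_k ,$$ let $\bar\xi_N,\bar\eta_N,\bar\zeta_N,\bar V_N$ be the averages of $\xi^i_n,\eta^i_n,\zeta^i_n,\hat\theta_i^2$ over $i=1,\dots,N$, and put $$\hat H=\tfrac12\log_2^+\Big(\frac{\bar\zeta_N-4h^2\bar V_N}{\bar\eta_N-h^2\bar V_N}\Big),\quad \hat\gamma^2=\frac{\bar\eta_N-h^2\bar V_N}{h^{2\hat H}(2^{2\hat H-1}-1)},\quad \hat\sigma^2=\frac{\bar\xi_N-h^2\bar V_N-\hat\gamma^2h^{2\hat H}}{h},\quad \hat\phi_i=\hat\theta_i+\tfrac12\hat\sigma^2 ,$$ where $\log_2^+x=\log_2x$ for $x>0$ and $\log_2^+x=0$ for $x\le0$ (fractions with zero denominator are given the value $0$). Let $\hat F_N(y)=\frac1N\sum_{i=1}^N\mathbf 1_{\{\hat\phi_i\le y\}}$ and $$\hat F_{m,n,N}(x)=\sum_{j=1}^m\hat F_N(x_j)\,\mathcal L_j(x),\qquad x_j=\cos\frac{(2j-1)\pi}{2m},\qquad \mathcal L_j(x)=\prod_{i\ne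 j}\frac{x-x_i}{x_j-x_i}.$$ Assume: (A1) $\mathbb E[\phi_i^4]<\infty$; (A2) $F$ is of class $C^2$ on $[-1,1]$; (A3) $f$ is differentiable on $[-1,1]$, and $f$ and $f'$ are bounded there. If $m=m(N)\to\infty$ and $m=o(\sqrt N/\log N)$ as $N\to\infty$, then $$\sup_{x\in[-1,1]}\big|\hat F_{m,n,N}(x)-F(x)\big|\longrightarrow0\quad\text{almost surely, as } n,N\to\infty ,$$ where $n$ and $N$ tend to infinity jointly, without any relation between them. -/

import Mathlib

open MeasureTheory ProbabilityTheory Filter Asymptotics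
open scoped NNReal ENNReal Topology

noncomputable section

namespace MixedFBS

/-- `X` is a fractional Brownian motion with Hurst index `H`: a centered Gaussian process on
`[0, ∞)` with covariance `(t ^ (2H) + s ^ (2H) - |t - s| ^ (2H)) / 2` and almost surely continuous
paths. -/
structure IsFractionalBrownianMotion {Ω : Type*} [MeasurableSpace Ω] (H : ℝ)
    (X : ℝ≥0 → Ω → ℝ) (P : Measure Ω) : Prop where
  gaussian : IsGaussianProcess X P
  mean : ∀ t, ∫ ω, X t ω ∂P = 0
  covariance : ∀ s t, cov[X s, X t; P] =
    ((t : ℝ) ^ (2 * H) + (s : ℝ) ^ (2 * H) - |(t : ℝ) - (s : ℝ)| ^ (2 * H)) / 2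
  continuous_paths : ∀ᵐ ω ∂P, Continuous fun t => X t ω

/-- The mixed process `M = σ B + γ B^H`. -/
def mixedProcess {Ω : Type*} (σ γ : ℝ) (B BH : ℝ≥0 → Ω → ℝ) (t : ℝ≥0) (ω : Ω) : ℝ :=
  σ * B t ω + γ * BH t ω

/-- The mixed fractional Black-Scholes process with random effect `φ` and `X_0 = 1`, that is the
solution `X_t = exp ((φ - σ² / 2) t + M_t)` of `dX = φ X dt + X dM`. -/
def blackScholes {Ω : Type*} (σ γ : ℝ) (φ : Ω → ℝ) (B BH : ℝ≥0 → Ω → ℝ) (t : ℝ≥0) (ω : Ω) : ℝ :=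
  Real.exp ((φ ω - σ ^ 2 / 2) * (t : ℝ) + mixedProcess σ γ B BH t ω)

/-- The log-observations `Y^i_{kh} = log X^i_{kh}` of subject `i` at the times `kh`. -/
def logObs {Ω : Type*} (σ γ : ℝ) (φ : ℕ → Ω → ℝ) (B BH : ℕ → ℝ≥0 → Ω → ℝ) (h : ℝ≥0)
    (ω : Ω) (i k : ℕ) : ℝ :=
  Real.log (blackScholes σ γ (φ i) (B i) (BH i) ((k : ℝ≥0) * h) ω)

/-! ### Statistics of one subject, as functions of its observations `y k = Y_{kh}` -/

/-- `ξ_n`, the mean of the squared increments. -/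
def xi (n : ℕ) (y : ℕ → ℝ) : ℝ :=
  (1 / (n : ℝ)) * ∑ k ∈ Finset.range n, (y (k + 1) - y k) ^ 2

/-- `η_n`, the mean of the products of consecutive increments. -/
def eta (n : ℕ) (y : ℕ → ℝ) : ℝ :=
  (1 / (n : ℝ)) * ∑ k ∈ Finset.range n, (y (k + 1) - y k) * (y (k + 2) - y (k + 1))

/-- `ζ_n`, the mean of the products of consecutive increments of step `2h`. -/
def zeta (n : ℕ) (y : ℕ → ℝ) : ℝ :=
  (1 / (n : ℝ)) * ∑ k ∈ Finset.range n, (y (k + 2) - y k) * (y (k + 4) - y (k + 2))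

/-- `θ̂`, the estimator of the trend. -/
def thetaHat (h : ℝ) (n : ℕ) (y : ℕ → ℝ) : ℝ :=
  (1 / ((n : ℝ) * h)) * ∑ k ∈ Finset.range n, (y (k + 1) - y k)

/-! ### Estimators, as functions of the observations `y i k = Y^i_{kh}` of all subjects;
the `N` subjects are `i = 0, …, N - 1` -/

/-- The average over the first `N` subjects. -/
def average (N : ℕ) (u : ℕ → ℝ) : ℝ := (1 / (N : ℝ)) * ∑ i ∈ Finset.range N, u i

/-- `V̄_N`, the average of the squares of the estimated trends. -/
def vBar (h : ℝ) (n N : ℕ) (y : ℕ → ℕ → ℝ) : ℝ :=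
  average N fun i => thetaHat h n (y i) ^ 2

/-- The binary logarithm, set to `0` on `(-∞, 0]`. -/
def logTwoPlus (x : ℝ) : ℝ := if 0 < x then Real.logb 2 x else 0

/-- `Ĥ`. -/
def hurstHat (h : ℝ) (n N : ℕ) (y : ℕ → ℕ → ℝ) : ℝ :=
  (1 / 2) * logTwoPlus
    (((average N fun i => zeta n (y i)) - 4 * h ^ 2 * vBar h n N y) /
      ((average N fun i => eta n (y i)) - h ^ 2 * vBar h n N y))

/-- `γ̂²`. -/
def gammaSqHat (h : ℝ) (n N : ℕ) (y : ℕ → ℕ → ℝ) : ℝ :=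
  ((average N fun i => eta n (y i)) - h ^ 2 * vBar h n N y) /
    (h ^ (2 * hurstHat h n N y) * ((2 : ℝ) ^ (2 * hurstHat h n N y - 1) - 1))

/-- `σ̂²`. -/
def sigmaSqHat (h : ℝ) (n N : ℕ) (y : ℕ → ℕ → ℝ) : ℝ :=
  ((average N fun i => xi n (y i)) - h ^ 2 * vBar h n N y
    - gammaSqHat h n N y * h ^ (2 * hurstHat h n N y)) / h

/-- `φ̂_i = θ̂_i + σ̂² / 2`, the plug-in estimator of the random effect of subject `i`. -/
def phiHat (h : ℝ) (n N : ℕ) (y : ℕ → ℕ → ℝ) (i : ℕ) : ℝ :=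
  thetaHat h n (y i) + (1 / 2) * sigmaSqHat h n N y

/-- `F̂_N`, the empirical distribution function of `φ̂_i`, `i < N`. -/
def ecdfHat (h : ℝ) (n N : ℕ) (y : ℕ → ℕ → ℝ) (x : ℝ) : ℝ :=
  average N fun i => if phiHat h n N y i ≤ x then 1 else 0

/-- The Chebyshev-Gauss nodes `x_j = cos ((2j - 1) π / (2m))`, `j = 1, …, m`. -/
def chebNode (m j : ℕ) : ℝ := Real.cos ((2 * (j : ℝ) - 1) * Real.pi / (2 * (m : ℝ)))

/-- `F̂_{m,n,N}`, the Lagrange interpolation of `F̂_N` at the `m` Chebyshev-Gauss nodes. -/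
def lagrangeEstimator (h : ℝ) (m n N : ℕ) (y : ℕ → ℕ → ℝ) (x : ℝ) : ℝ :=
  ∑ j ∈ Finset.Icc 1 m, ecdfHat h n N y (chebNode m j) *
    (Lagrange.basis (Finset.Icc 1 m) (chebNode m) j).eval x

end MixedFBS

end

/-!
The estimated effect of subject `i` is `φ̂ i = φ i + T i n + δ`, where `T i n` is the time average
over `n` observations of the noise of subject `i`, divided by `h`, and `δ = (σ̂² - σ²) / 2` does not
depend on `i`. Hence `F̂ (x)` is the empirical distribution function of the independent variables
`φ i + T i n`, `i < N`, at the point `x - δ`, and three facts give the theorem.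

*Consistency of `σ̂²`* (`tendsto_sigmaSqHat`). By polarization the statistics `ξ`, `η`, `ζ` are
combinations of the averages of squared increments of the noise over `1`, `2` and `4` time steps, up
to terms which are corrected by `θ̂²` or are negligible. These averages are nonnegative, so their
joint limit in `n` and `N` follows from Chebyshev's inequality and a Borel–Cantelli argument along
polynomial subsequences of both indices, by monotonicity in between
(`ae_tendsto_average_incr_sq`). The variances needed come from Isserlis' formula
`Cov (X ^ 2, Y ^ 2) = 2 Cov (X, Y) ^ 2`; they decay only like a small power of `1 / n` when `H` is
close to `1`, and this is why the subsequence in `n` depends on `H`.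

*Empirical distribution functions* (`exists_lipschitz_approx_ecdf`). Hoeffding's inequality on a
grid of step `1 / N` gives deviations at most of order `N ^ (-1/4)`, outside an event of probability
`O (N ^ (-d))` for every `d`. Borel–Cantelli over the pairs `(n, N)` needs in addition summability
in `n`. With a large fixed exponent `κ`, the pairs with `n < N ^ κ` are handled by a large `d`; when
`n ≥ N ^ κ`, Markov's inequality for a high moment of the Gaussian variables `T i n` shows that all
of them are at most `N ^ (-1/4)`, and the empirical distribution function is compared with that of
the `φ i`, which does not depend on `n`. As `φ i` has a bounded density, all the limits are
Lipschitz with the same constant.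

*Stability of interpolation* (`abs_interpolation_sub_le`). The Lebesgue constant of the `m`
Chebyshev nodes is `O (log m)`, and an equi-Lipschitz family is approximated by polynomials of
degree less than `m` at the rate `1 / √m`, through Bernstein polynomials. Since
`log m * (N ^ (-1/4) + 1 / √m)` tends to zero, the interpolation error vanishes uniformly.
-/

noncomputable section

namespace MixedFBS

/-! ### Lagrange interpolation at the Chebyshev nodes -/

/-- The angle `(2j - 1) π / (2m)` whose cosine is the `j`-th Chebyshev node. -/
def chebAngle (m j : ℕ) : ℝ := (2 * (j : ℝ) - 1) * Real.pi / (2 * (m : ℝ))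

lemma chebNode_eq_cos (m j : ℕ) : chebNode m j = Real.cos (chebAngle m j) := rfl

lemma chebAngle_mem {m j : ℕ} (hj : j ∈ Finset.Icc 1 m) :
    0 < chebAngle m j ∧ chebAngle m j < Real.pi := by
  rw [Finset.mem_Icc] at hj
  have h1 : (1 : ℝ) ≤ j := by exact_mod_cast hj.1
  have h2 : (j : ℝ) ≤ m := by exact_mod_cast hj.2
  have hm : (0 : ℝ) < m := by linarith
  have hp := Real.pi_pos
  unfold chebAngle
  constructor
  · apply div_pos (mul_pos (by linarith) hp) (by linarith)
  · rw [div_lt_iff₀ (by linarith)]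
    nlinarith

lemma chebNode_injOn (m : ℕ) : Set.InjOn (chebNode m) (Finset.Icc 1 m : Finset ℕ) := by
  intro i hi j hj hij
  have hi' := chebAngle_mem hi
  have hj' := chebAngle_mem hj
  have h := Real.injOn_cos ⟨hi'.1.le, hi'.2.le⟩ ⟨hj'.1.le, hj'.2.le⟩ hij
  have hm : (0 : ℝ) < m := by
    have := Finset.mem_Icc.1 (Finset.mem_coe.1 hi)
    exact_mod_cast (by omega : 0 < m)
  unfold chebAngle at h
  rw [div_left_inj' (by positivity)] at h
  have := mul_right_cancel₀ Real.pi_ne_zero h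
  exact_mod_cast (by linarith : (i : ℝ) = j)

lemma mul_chebAngle {m : ℕ} (hm : m ≠ 0) (j : ℕ) :
    (m : ℝ) * chebAngle m j = (j : ℝ) * Real.pi - Real.pi / 2 := by
  have : (m : ℝ) ≠ 0 := by exact_mod_cast hm
  unfold chebAngle; field_simp

lemma cos_mul_chebAngle {m : ℕ} (hm : m ≠ 0) (j : ℕ) :
    Real.cos ((m : ℝ) * chebAngle m j) = 0 := by
  rw [mul_chebAngle hm, Real.cos_sub_pi_div_two, Real.sin_nat_mul_pi]

lemma abs_sin_mul_chebAngle {m : ℕ} (hm : m ≠ 0) (j : ℕ) :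
    |Real.sin ((m : ℝ) * chebAngle m j)| = 1 := by
  rw [mul_chebAngle hm, Real.sin_sub_pi_div_two, abs_neg, Real.cos_nat_mul_pi]
  simp

/-- The Chebyshev polynomial is a multiple of the nodal polynomial of its zeros. -/
lemma chebyshev_T_eq_nodal {m : ℕ} (hm : m ≠ 0) :
    Polynomial.Chebyshev.T ℝ m =
      Polynomial.C (2 ^ (m - 1)) * Lagrange.nodal (Finset.Icc 1 m) (chebNode m) := by
  have hc : (2 : ℝ) ^ (m - 1) ≠ 0 := by positivity
  have hdeg : (Polynomial.C (2 ^ (m - 1) : ℝ) *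
      Lagrange.nodal (Finset.Icc 1 m) (chebNode m)).degree = (m : WithBot ℕ) := by
    rw [Polynomial.degree_C_mul hc, Lagrange.degree_nodal]; simp
  refine Polynomial.eq_of_degree_sub_lt_of_eval_index_eq (s := Finset.Icc 1 m) (v := chebNode m)
    (chebNode_injOn m) ?_ ?_
  · have h := Polynomial.degree_sub_lt_left (p := Polynomial.Chebyshev.T ℝ m)
      (q := Polynomial.C (2 ^ (m - 1)) * Lagrange.nodal (Finset.Icc 1 m) (chebNode m)) ?_ ?_ ?_
    · refine h.trans_le ?_
      rw [Polynomial.Chebyshev.degree_T]; simp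
    · rw [Polynomial.Chebyshev.degree_T, hdeg]; simp
    · exact Polynomial.Chebyshev.T_ne_zero ℝ _
    · rw [Polynomial.Chebyshev.leadingCoeff_T, Polynomial.leadingCoeff_mul,
        Polynomial.leadingCoeff_C, (Lagrange.nodal_monic).leadingCoeff]
      simp
  · intro j hj
    rw [Polynomial.eval_mul, Lagrange.eval_nodal_at_node hj, mul_zero, chebNode_eq_cos,
      Polynomial.Chebyshev.T_real_cos]
    exact_mod_cast cos_mul_chebAngle hm j

/-- The closed form of the Lagrange basis at the Chebyshev nodes, in the angular variable and up
to sign. -/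
lemma abs_basis_mul {m j : ℕ} (hj : j ∈ Finset.Icc 1 m) (t : ℝ) :
    |(Lagrange.basis (Finset.Icc 1 m) (chebNode m) j).eval (Real.cos t)| *
      (m * |Real.cos t - Real.cos (chebAngle m j)|) =
      |Real.cos (m * t)| * Real.sin (chebAngle m j) := by
  have hm : m ≠ 0 := by have := Finset.mem_Icc.1 hj; omega
  have ha := chebAngle_mem hj
  have hs : 0 < Real.sin (chebAngle m j) := Real.sin_pos_of_pos_of_lt_pi ha.1 ha.2
  have hc : (2 : ℝ) ^ (m - 1) ≠ 0 := by positivity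
  by_cases hx : Real.cos t = chebNode m j
  · have h0 : Real.cos (m * t) = 0 := by
      have h1 := Polynomial.Chebyshev.T_real_cos t m
      have h2 := Polynomial.Chebyshev.T_real_cos (chebAngle m j) m
      rw [hx, chebNode_eq_cos, h2] at h1
      have := cos_mul_chebAngle hm j
      rw [← this]; exact_mod_cast h1.symm
    rw [h0, hx, chebNode_eq_cos]; simp
  · have hx' : Real.cos t - chebNode m j ≠ 0 := sub_ne_zero.2 hx
    have hT := chebyshev_T_eq_nodal hm
    have hev : Real.cos (m * t) =
        2 ^ (m - 1) * (Lagrange.nodal (Finset.Icc 1 m) (chebNode m)).eval (Real.cos t) := by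
      have h1 := Polynomial.Chebyshev.T_real_cos t m
      rw [hT] at h1
      simpa using h1.symm
    have hder : (m : ℝ) * Real.sin (m * chebAngle m j) =
        2 ^ (m - 1) * (Polynomial.derivative (Lagrange.nodal (Finset.Icc 1 m) (chebNode m))).eval
          (chebNode m j) * Real.sin (chebAngle m j) := by
      have h1 := congrArg (fun p => (Polynomial.derivative p).eval (chebNode m j)) hT
      simp only [Polynomial.Chebyshev.T_derivative_eq_U, Polynomial.derivative_C_mul,
        Polynomial.eval_mul, Polynomial.eval_C] at h1
      have h2 := Polynomial.Chebyshev.U_real_cos (chebAngle m j) ((m : ℤ) - 1)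
      rw [← h1, mul_assoc, chebNode_eq_cos, h2]
      simp
    set d := (Polynomial.derivative (Lagrange.nodal (Finset.Icc 1 m) (chebNode m))).eval
          (chebNode m j) with hd
    set w := (Lagrange.nodal (Finset.Icc 1 m) (chebNode m)).eval (Real.cos t) with hw
    have hm' : (m : ℝ) ≠ 0 := by exact_mod_cast hm
    have habs := abs_sin_mul_chebAngle hm j
    have hd0 : d ≠ 0 := by
      intro h
      rw [h, mul_zero, zero_mul] at hder
      rcases mul_eq_zero.1 hder with h | h
      · exact hm' h
      · rw [h] at habs; simp at habs
    rw [Lagrange.eval_basis_not_at_node hj hx, Lagrange.nodalWeight_eq_eval_derivative_nodal hj,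
      ← hd, ← hw, hev]
    have e : (m : ℝ) = |2 ^ (m - 1) * d| * Real.sin (chebAngle m j) := by
      have := congrArg abs hder
      rw [abs_mul, habs, mul_one, Nat.abs_cast, abs_mul _ (Real.sin _), abs_of_pos hs] at this
      exact this
    rw [← chebNode_eq_cos]
    nth_rewrite 1 [e]
    simp only [abs_mul, abs_inv]
    have h1 : |d| ≠ 0 := abs_ne_zero.2 hd0
    have h2 : |Real.cos t - chebNode m j| ≠ 0 := abs_ne_zero.2 hx'
    field_simp

/-- `|cos s - cos t|` is at least `sin t |s - t| / π` on `[0, π]`. -/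
lemma sin_mul_abs_sub_le {s t : ℝ} (hs : 0 ≤ s ∧ s ≤ Real.pi) (ht : 0 ≤ t ∧ t ≤ Real.pi) :
    Real.sin t * |s - t| ≤ Real.pi * |Real.cos s - Real.cos t| := by
  have hp := Real.pi_pos
  rw [Real.cos_sub_cos, abs_mul, abs_mul]
  have h1 : Real.sin t ≤ 2 * |Real.sin ((s + t) / 2)| := by
    have hss : 0 ≤ Real.sin s := Real.sin_nonneg_of_nonneg_of_le_pi hs.1 hs.2
    have e : Real.sin s + Real.sin t =
        2 * Real.sin ((s + t) / 2) * Real.cos ((s - t) / 2) := by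
      have h1 := Real.sin_add ((s + t) / 2) ((s - t) / 2)
      have h2 := Real.sin_sub ((s + t) / 2) ((s - t) / 2)
      rw [show (s + t) / 2 + (s - t) / 2 = s by ring] at h1
      rw [show (s + t) / 2 - (s - t) / 2 = t by ring] at h2
      linarith
    have h3 : Real.sin ((s + t) / 2) * Real.cos ((s - t) / 2) ≤ |Real.sin ((s + t) / 2)| := by
      calc _ ≤ |Real.sin ((s + t) / 2) * Real.cos ((s - t) / 2)| := le_abs_self _
        _ = |Real.sin ((s + t) / 2)| * |Real.cos ((s - t) / 2)| := abs_mul _ _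
        _ ≤ |Real.sin ((s + t) / 2)| * 1 := by gcongr; exact Real.abs_cos_le_one _
        _ = _ := mul_one _
    linarith
  have h2 : |s - t| ≤ Real.pi * |Real.sin ((s - t) / 2)| := by
    have key : ∀ u : ℝ, 0 ≤ u → u ≤ Real.pi → u ≤ Real.pi * Real.sin (u / 2) := by
      intro u hu hu'
      have := Real.mul_le_sin (x := u / 2) (by linarith) (by linarith)
      calc u = Real.pi * (2 / Real.pi * (u / 2)) := by field_simp
        _ ≤ _ := by gcongr
    rcases le_total 0 (s - t) with h | h
    · rw [abs_of_nonneg h]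
      exact (key _ h (by linarith)).trans (by gcongr; exact le_abs_self _)
    · rw [abs_of_nonpos h, ← abs_neg (Real.sin _), ← Real.sin_neg,
        show -((s - t) / 2) = -(s - t) / 2 by ring]
      exact (key _ (by linarith) (by linarith)).trans (by gcongr; exact le_abs_self _)
  have hst : 0 ≤ Real.sin t := Real.sin_nonneg_of_nonneg_of_le_pi ht.1 ht.2
  calc Real.sin t * |s - t|
      ≤ (2 * |Real.sin ((s + t) / 2)|) * (Real.pi * |Real.sin ((s - t) / 2)|) := by
        gcongr
    _ = _ := by simp; ring

lemma basis_le_far {m j : ℕ} (hj : j ∈ Finset.Icc 1 m) {t : ℝ} (ht : 0 ≤ t ∧ t ≤ Real.pi) :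
    |(Lagrange.basis (Finset.Icc 1 m) (chebNode m) j).eval (Real.cos t)| *
      (m * |t - chebAngle m j|) ≤ Real.pi := by
  have ha := chebAngle_mem hj
  have hs : 0 < Real.sin (chebAngle m j) := Real.sin_pos_of_pos_of_lt_pi ha.1 ha.2
  have h1 := abs_basis_mul hj t
  have h2 := sin_mul_abs_sub_le ht ⟨ha.1.le, ha.2.le⟩
  set A := |(Lagrange.basis (Finset.Icc 1 m) (chebNode m) j).eval (Real.cos t)|
  refine le_of_mul_le_mul_left ?_ hs
  calc Real.sin (chebAngle m j) * (A * (m * |t - chebAngle m j|))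
      = A * m * (Real.sin (chebAngle m j) * |t - chebAngle m j|) := by ring
    _ ≤ A * m * (Real.pi * |Real.cos t - Real.cos (chebAngle m j)|) := by gcongr
    _ = Real.pi * (|Real.cos (m * t)| * Real.sin (chebAngle m j)) := by rw [← h1]; ring
    _ ≤ Real.pi * (1 * Real.sin (chebAngle m j)) := by
        gcongr; exact Real.abs_cos_le_one _
    _ = _ := by ring

lemma basis_le_near {m j : ℕ} (hj : j ∈ Finset.Icc 1 m) {t : ℝ} (ht : 0 ≤ t ∧ t ≤ Real.pi) :
    |(Lagrange.basis (Finset.Icc 1 m) (chebNode m) j).eval (Real.cos t)| ≤ Real.pi := by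
  have hm : m ≠ 0 := by have := Finset.mem_Icc.1 hj; omega
  have hm' : (0 : ℝ) < m := by exact_mod_cast Nat.pos_of_ne_zero hm
  have ha := chebAngle_mem hj
  have hs : 0 < Real.sin (chebAngle m j) := Real.sin_pos_of_pos_of_lt_pi ha.1 ha.2
  by_cases htt : t = chebAngle m j
  · rw [htt, ← chebNode_eq_cos, Lagrange.eval_basis_self (chebNode_injOn m) hj]
    simpa using (by linarith [Real.pi_gt_three] : (1 : ℝ) ≤ Real.pi)
  have hd : 0 < |t - chebAngle m j| := abs_pos.2 (sub_ne_zero.2 htt)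
  have h1 := abs_basis_mul hj t
  have h2 := sin_mul_abs_sub_le ht ⟨ha.1.le, ha.2.le⟩
  have h3 : |Real.cos (m * t)| ≤ m * |t - chebAngle m j| := by
    have := Real.abs_cos_sub_cos_le (m * t) (m * chebAngle m j)
    rwa [cos_mul_chebAngle hm, sub_zero, ← mul_sub, abs_mul, Nat.abs_cast] at this
  set A := |(Lagrange.basis (Finset.Icc 1 m) (chebNode m) j).eval (Real.cos t)|
  refine le_of_mul_le_mul_left ?_ (mul_pos (mul_pos hm' hs) hd)
  calc m * Real.sin (chebAngle m j) * |t - chebAngle m j| * A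
      = A * m * (Real.sin (chebAngle m j) * |t - chebAngle m j|) := by ring
    _ ≤ A * m * (Real.pi * |Real.cos t - Real.cos (chebAngle m j)|) := by gcongr
    _ = Real.pi * (|Real.cos (m * t)| * Real.sin (chebAngle m j)) := by rw [← h1]; ring
    _ ≤ Real.pi * (m * |t - chebAngle m j| * Real.sin (chebAngle m j)) := by gcongr
    _ = _ := by ring

/-- The Lagrange basis polynomials at the Chebyshev nodes decay with the distance of the index
to the index `k` of a node next to the point. -/
lemma basis_decay {m : ℕ} (hm : m ≠ 0) {t : ℝ} (ht : 0 ≤ t ∧ t ≤ Real.pi) :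
    ∃ k ≤ m, ∀ j ∈ Finset.Icc 1 m,
      |(Lagrange.basis (Finset.Icc 1 m) (chebNode m) j).eval (Real.cos t)| ≤
        8 / (1 + |(j : ℝ) - k|) := by
  have hm' : (0 : ℝ) < m := by exact_mod_cast Nat.pos_of_ne_zero hm
  have hp := Real.pi_pos
  set u : ℝ := m * t / Real.pi + 1 / 2 with hu
  have hu0 : 0 ≤ u := by have := ht.1; positivity
  have hum : u ≤ m + 1 / 2 := by
    have : m * t / Real.pi ≤ m := by
      rw [div_le_iff₀ hp]; exact mul_le_mul_of_nonneg_left ht.2 hm'.le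
    linarith
  have hk1 : (⌊u⌋₊ : ℝ) ≤ u := Nat.floor_le hu0
  have hk2 : u < ⌊u⌋₊ + 1 := Nat.lt_floor_add_one u
  refine ⟨⌊u⌋₊, ?_, ?_⟩
  · have : (⌊u⌋₊ : ℝ) < m + 1 := by linarith
    have : ⌊u⌋₊ < m + 1 := by exact_mod_cast this
    omega
  intro j hj
  set k := ⌊u⌋₊
  have hfar := basis_le_far hj ht
  have hnear := basis_le_near hj ht
  set A := |(Lagrange.basis (Finset.Icc 1 m) (chebNode m) j).eval (Real.cos t)| with hA
  have hA0 : 0 ≤ A := abs_nonneg _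
  have e : m * |t - chebAngle m j| = Real.pi * |u - j| := by
    have e1 : (m : ℝ) * (t - chebAngle m j) = Real.pi * (u - j) := by
      rw [mul_sub, mul_chebAngle hm, hu]; field_simp; ring
    rw [← Nat.abs_cast m, ← abs_mul, e1, abs_mul, abs_of_pos hp]
  rw [e] at hfar
  have hfar' : A * |u - j| ≤ 1 := by
    refine le_of_mul_le_mul_left ?_ hp
    linarith
  rw [le_div_iff₀ (by positivity)]
  have htri : |(j : ℝ) - k| ≤ |u - j| + 1 := by
    have : |u - k| ≤ 1 := by rw [abs_le]; constructor <;> linarith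
    calc |(j : ℝ) - k| = |(u - k) - (u - j)| := by ring_nf
      _ ≤ |u - k| + |u - j| := abs_sub _ _
      _ ≤ _ := by linarith
  have hpi := Real.pi_lt_d2
  calc A * (1 + |(j : ℝ) - k|) ≤ A * (|u - j| + 2) :=
        mul_le_mul_of_nonneg_left (by linarith) hA0
    _ = A * |u - j| + 2 * A := by ring
    _ ≤ 1 + 2 * Real.pi := by linarith
    _ ≤ _ := by norm_num at hpi; linarith

lemma sum_inv_one_add_dist_le {m k : ℕ} (hk : k ≤ m) :
    ∑ j ∈ Finset.Icc 1 m, 1 / (1 + |(j : ℝ) - k|) ≤ 2 * (1 + Real.log (m + 1)) := by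
  have hH : ∑ d ∈ Finset.range (m + 1), 1 / (1 + (d : ℝ)) ≤ 1 + Real.log (m + 1) := by
    have := harmonic_le_one_add_log (m + 1)
    simp only [harmonic] at this
    push_cast at this
    refine le_trans (le_of_eq (Finset.sum_congr rfl fun d _ => ?_)) this
    rw [one_div, add_comm]
  have hpos : ∀ d : ℕ, 0 ≤ 1 / (1 + (d : ℝ)) := fun d => by positivity
  rw [← Finset.sum_filter_add_sum_filter_not _ (fun j => j ≤ k), two_mul]
  refine add_le_add ?_ ?_
  · refine le_trans ?_ hH
    calc _ = ∑ j ∈ (Finset.Icc 1 m).filter (fun j => j ≤ k), 1 / (1 + ((k - j : ℕ) : ℝ)) := by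
          refine Finset.sum_congr rfl fun j hj => ?_
          have hjk := (Finset.mem_filter.1 hj).2
          rw [abs_sub_comm, Nat.cast_sub hjk, abs_of_nonneg]
          exact sub_nonneg.2 (by exact_mod_cast hjk)
      _ = ∑ d ∈ ((Finset.Icc 1 m).filter (fun j => j ≤ k)).image (fun j => k - j),
            1 / (1 + (d : ℝ)) := by
          rw [Finset.sum_image]
          intro a ha b hb hab
          have ha := (Finset.mem_filter.1 ha).2
          have hb := (Finset.mem_filter.1 hb).2
          simp only at hab; omega
      _ ≤ _ := by
          refine Finset.sum_le_sum_of_subset_of_nonneg ?_ fun d _ _ => hpos d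
          intro d hd
          obtain ⟨j, -, rfl⟩ := Finset.mem_image.1 hd
          rw [Finset.mem_range]; omega
  · refine le_trans ?_ hH
    calc _ = ∑ j ∈ (Finset.Icc 1 m).filter (fun j => ¬ j ≤ k), 1 / (1 + ((j - k : ℕ) : ℝ)) := by
          refine Finset.sum_congr rfl fun j hj => ?_
          have hjk : k ≤ j := by have := (Finset.mem_filter.1 hj).2; omega
          rw [Nat.cast_sub hjk, abs_of_nonneg]
          exact sub_nonneg.2 (by exact_mod_cast hjk)
      _ = ∑ d ∈ ((Finset.Icc 1 m).filter (fun j => ¬ j ≤ k)).image (fun j => j - k),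
            1 / (1 + (d : ℝ)) := by
          rw [Finset.sum_image]
          intro a ha b hb hab
          have ha := (Finset.mem_filter.1 ha).2
          have hb := (Finset.mem_filter.1 hb).2
          simp only at hab; omega
      _ ≤ _ := by
          refine Finset.sum_le_sum_of_subset_of_nonneg ?_ fun d _ _ => hpos d
          intro d hd
          obtain ⟨j, hj, rfl⟩ := Finset.mem_image.1 hd
          have := Finset.mem_Icc.1 (Finset.mem_filter.1 hj).1
          rw [Finset.mem_range]; omega

/-- The Lebesgue constant of the Chebyshev nodes grows at most logarithmically. -/
lemma sum_abs_basis_le {m : ℕ} (hm : m ≠ 0) {x : ℝ} (hx : x ∈ Set.Icc (-1 : ℝ) 1) :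
    ∑ j ∈ Finset.Icc 1 m, |(Lagrange.basis (Finset.Icc 1 m) (chebNode m) j).eval x| ≤
      16 * (1 + Real.log (m + 1)) := by
  obtain ⟨k, hk, hb⟩ := basis_decay hm ⟨Real.arccos_nonneg x, Real.arccos_le_pi x⟩
  rw [Real.cos_arccos hx.1 hx.2] at hb
  calc _ ≤ ∑ j ∈ Finset.Icc 1 m, 8 * (1 / (1 + |(j : ℝ) - k|)) := by
        refine Finset.sum_le_sum fun j hj => (hb j hj).trans (le_of_eq (by ring))
    _ ≤ 8 * (2 * (1 + Real.log (m + 1))) := by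
        rw [← Finset.mul_sum]
        exact mul_le_mul_of_nonneg_left (sum_inv_one_add_dist_le hk) (by norm_num)
    _ = _ := by ring

/-- The Bernstein polynomial of degree `m` of a Lipschitz function `g` approximates it at the rate
`m ^ (-1/2)` on `[0, 1]`, by the Cauchy-Schwarz inequality for the binomial weights. -/
lemma exists_polynomial_near_unitInterval {g : ℝ → ℝ} {K : ℝ} (hK : 0 ≤ K)
    (hg : ∀ x y, |g x - g y| ≤ K * |x - y|) {m : ℕ} (hm : m ≠ 0) :
    ∃ p : Polynomial ℝ, p.natDegree ≤ m ∧
      ∀ x ∈ Set.Icc (0 : ℝ) 1, |p.eval x - g x| ≤ K / (2 * Real.sqrt m) := by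
  have hm' : (0 : ℝ) < m := by exact_mod_cast Nat.pos_of_ne_zero hm
  refine ⟨∑ k ∈ Finset.range (m + 1), Polynomial.C (g (k / m)) * bernsteinPolynomial ℝ m k,
    ?_, ?_⟩
  · refine Polynomial.natDegree_sum_le_of_forall_le _ _ fun k hk => ?_
    have hk' : k ≤ m := by have := Finset.mem_range.1 hk; omega
    refine (Polynomial.natDegree_C_mul_le _ _).trans ?_
    unfold bernsteinPolynomial
    rw [← Polynomial.C_eq_natCast, mul_assoc]
    refine (Polynomial.natDegree_C_mul_le _ _).trans (Polynomial.natDegree_mul_le.trans ?_)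
    have h1 : (Polynomial.X ^ k : Polynomial ℝ).natDegree ≤ k := by simp
    have h2 : ((1 - Polynomial.X : Polynomial ℝ) ^ (m - k)).natDegree ≤ (m - k) * 1 := by
      refine Polynomial.natDegree_pow_le_of_le _ ?_
      refine (Polynomial.natDegree_sub_le _ _).trans ?_
      simp
    omega
  · intro x hx
    set b : ℕ → ℝ := fun k => (bernsteinPolynomial ℝ m k).eval x with hb
    have hb0 : ∀ k, 0 ≤ b k := by
      intro k
      simp only [hb, bernsteinPolynomial, Polynomial.eval_mul, Polynomial.eval_pow,
        Polynomial.eval_X, Polynomial.eval_sub, Polynomial.eval_one, Polynomial.eval_natCast]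
      have := hx.1
      have : 0 ≤ 1 - x := by linarith [hx.2]
      positivity
    have hsum : ∑ k ∈ Finset.range (m + 1), b k = 1 := by
      have := congrArg (Polynomial.eval x) (bernsteinPolynomial.sum ℝ m)
      simpa [Polynomial.eval_finsetSum] using this
    have hvar : ∑ k ∈ Finset.range (m + 1), (m * x - k) ^ 2 * b k = m * x * (1 - x) := by
      have := congrArg (Polynomial.eval x) (bernsteinPolynomial.variance ℝ m)
      simpa [Polynomial.eval_finsetSum] using this
    have h1 : (∑ k ∈ Finset.range (m + 1), |m * x - k| * b k) ^ 2 ≤ m / 4 := by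
      have h := Finset.sum_mul_sq_le_sq_mul_sq (Finset.range (m + 1))
        (fun k => |m * x - k| * Real.sqrt (b k)) (fun k => Real.sqrt (b k))
      have e1 : ∀ k : ℕ, |m * x - k| * Real.sqrt (b k) * Real.sqrt (b k) = |m * x - k| * b k := by
        intro k; rw [mul_assoc, Real.mul_self_sqrt (hb0 k)]
      have e2 : ∀ k : ℕ, (|m * x - k| * Real.sqrt (b k)) ^ 2 = (m * x - k) ^ 2 * b k := by
        intro k; rw [mul_pow, sq_abs, Real.sq_sqrt (hb0 k)]
      have e3 : ∀ k : ℕ, Real.sqrt (b k) ^ 2 = b k := fun k => Real.sq_sqrt (hb0 k)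
      simp only [e1, e2, e3] at h
      rw [hsum, hvar, mul_one] at h
      refine h.trans ?_
      nlinarith [sq_nonneg (x - 1 / 2)]
    have h2 : ∑ k ∈ Finset.range (m + 1), |m * x - k| * b k ≤ Real.sqrt m / 2 := by
      refine abs_le_of_sq_le_sq' ?_ (by positivity) |>.2
      rw [div_pow, Real.sq_sqrt hm'.le]; norm_num; linarith
    have e : (∑ k ∈ Finset.range (m + 1), Polynomial.C (g (k / m)) *
        bernsteinPolynomial ℝ m k).eval x - g x =
        ∑ k ∈ Finset.range (m + 1), (g (k / m) - g x) * b k := by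
      simp only [sub_mul, Finset.sum_sub_distrib]
      rw [← Finset.mul_sum, hsum, mul_one]
      simp [Polynomial.eval_finsetSum, hb]
    rw [e]
    calc _ ≤ ∑ k ∈ Finset.range (m + 1), |(g (k / m) - g x) * b k| :=
          Finset.abs_sum_le_sum_abs _ _
      _ ≤ ∑ k ∈ Finset.range (m + 1), (K / m) * (|m * x - k| * b k) := by
          refine Finset.sum_le_sum fun k _ => ?_
          rw [abs_mul, abs_of_nonneg (hb0 k), ← mul_assoc]
          refine mul_le_mul_of_nonneg_right ((hg _ _).trans (le_of_eq ?_)) (hb0 k)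
          rw [div_mul_eq_mul_div, mul_div_assoc]
          congr 1
          rw [eq_div_iff hm'.ne', ← Nat.abs_cast m, ← abs_mul, Nat.abs_cast, abs_sub_comm]
          congr 1; field_simp
      _ ≤ (K / m) * (Real.sqrt m / 2) := by
          rw [← Finset.mul_sum]; gcongr
      _ = _ := by
          have hs : Real.sqrt m ≠ 0 := (Real.sqrt_pos.2 hm').ne'
          have : (m : ℝ) = Real.sqrt m * Real.sqrt m := (Real.mul_self_sqrt hm'.le).symm
          nth_rewrite 1 [this]
          field_simp

lemma exists_polynomial_near {g : ℝ → ℝ} {K : ℝ} (hK : 0 ≤ K)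
    (hg : ∀ x y, |g x - g y| ≤ K * |x - y|) {m : ℕ} (hm : m ≠ 0) :
    ∃ p : Polynomial ℝ, p.natDegree ≤ m ∧
      ∀ x ∈ Set.Icc (-1 : ℝ) 1, |p.eval x - g x| ≤ K / Real.sqrt m := by
  obtain ⟨p, hp, hpg⟩ := exists_polynomial_near_unitInterval (g := fun t => g (2 * t - 1))
    (K := 2 * K) (by positivity) (fun x y => by
      refine (hg _ _).trans (le_of_eq ?_)
      rw [show 2 * x - 1 - (2 * y - 1) = 2 * (x - y) by ring, abs_mul, abs_two]; ring) hm
  refine ⟨p.comp (Polynomial.C (1 / 2) * Polynomial.X + Polynomial.C (1 / 2)), ?_, ?_⟩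
  · rw [Polynomial.natDegree_comp, Polynomial.natDegree_linear (by norm_num)]; omega
  · intro x hx
    have h := hpg (1 / 2 * x + 1 / 2) ⟨by linarith [hx.1], by linarith [hx.2]⟩
    simp only [Polynomial.eval_comp, Polynomial.eval_add, Polynomial.eval_mul,
      Polynomial.eval_C, Polynomial.eval_X]
    rw [show 2 * (1 / 2 * x + 1 / 2) - 1 = x by ring] at h
    refine h.trans (le_of_eq ?_)
    rw [mul_div_mul_left _ _ two_ne_zero]

/-- Stability of Lagrange interpolation at the Chebyshev nodes: data `a` within `ε` of a Lipschitz
function `g` at the nodes are interpolated by a polynomial close to `g` on `[-1, 1]`. -/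
lemma abs_interpolation_sub_le {g : ℝ → ℝ} {K : ℝ} (hK : 0 ≤ K)
    (hg : ∀ x y, |g x - g y| ≤ K * |x - y|) {m : ℕ} (hm : m ≠ 0) {a : ℕ → ℝ} {ε : ℝ}
    (ha : ∀ j ∈ Finset.Icc 1 (m + 1), |a j - g (chebNode (m + 1) j)| ≤ ε)
    {x : ℝ} (hx : x ∈ Set.Icc (-1 : ℝ) 1) :
    |∑ j ∈ Finset.Icc 1 (m + 1), a j *
      (Lagrange.basis (Finset.Icc 1 (m + 1)) (chebNode (m + 1)) j).eval x - g x| ≤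
      16 * (1 + Real.log (m + 2)) * (ε + K / Real.sqrt m) + K / Real.sqrt m := by
  obtain ⟨p, hp, hpg⟩ := exists_polynomial_near hK hg hm
  have hrep := Lagrange.eq_interpolate (s := Finset.Icc 1 (m + 1)) (v := chebNode (m + 1)) (f := p)
    (chebNode_injOn _) (by
      refine (Polynomial.degree_le_of_natDegree_le hp).trans_lt ?_
      simp only [Nat.card_Icc, Nat.add_sub_cancel]
      exact_mod_cast Nat.lt_succ_self m)
  have hpx : p.eval x = ∑ j ∈ Finset.Icc 1 (m + 1), p.eval (chebNode (m + 1) j) *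
      (Lagrange.basis (Finset.Icc 1 (m + 1)) (chebNode (m + 1)) j).eval x := by
    conv_lhs => rw [hrep]
    simp [Lagrange.interpolate_apply, Polynomial.eval_finsetSum]
  have hL := sum_abs_basis_le (Nat.succ_ne_zero m) hx
  push_cast at hL
  rw [show (m : ℝ) + 1 + 1 = m + 2 by ring] at hL
  set l : ℕ → ℝ := fun j =>
    (Lagrange.basis (Finset.Icc 1 (m + 1)) (chebNode (m + 1)) j).eval x
  have hε : 0 ≤ ε := (abs_nonneg _).trans (ha 1 (by simp))
  have e : ∑ j ∈ Finset.Icc 1 (m + 1), a j * l j - g x =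
      ∑ j ∈ Finset.Icc 1 (m + 1), (a j - p.eval (chebNode (m + 1) j)) * l j +
        (p.eval x - g x) := by
    rw [hpx]; simp only [sub_mul, Finset.sum_sub_distrib]; ring
  rw [e]
  refine (abs_add_le _ _).trans (add_le_add ?_ (hpg x hx))
  calc _ ≤ ∑ j ∈ Finset.Icc 1 (m + 1), |(a j - p.eval (chebNode (m + 1) j)) * l j| :=
        Finset.abs_sum_le_sum_abs _ _
    _ ≤ ∑ j ∈ Finset.Icc 1 (m + 1), (ε + K / Real.sqrt m) * |l j| := by
        refine Finset.sum_le_sum fun j hj => ?_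
        rw [abs_mul]
        refine mul_le_mul_of_nonneg_right ?_ (abs_nonneg _)
        have h1 := ha j hj
        have h2 := hpg (chebNode (m + 1) j)
          ⟨Real.neg_one_le_cos _, Real.cos_le_one _⟩
        rw [abs_sub_comm] at h2
        calc _ ≤ |a j - g (chebNode (m + 1) j)| +
              |g (chebNode (m + 1) j) - p.eval (chebNode (m + 1) j)| := abs_sub_le _ _ _
          _ ≤ _ := add_le_add h1 h2
    _ = (∑ j ∈ Finset.Icc 1 (m + 1), |l j|) * (ε + K / Real.sqrt m) := by
        rw [← Finset.mul_sum, mul_comm]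
    _ ≤ _ := by gcongr

/-! ### Moments of Gaussian variables -/

section Gaussian

variable {Ω : Type*} [MeasurableSpace Ω] {P : Measure Ω}

/-- The moments of the standard normal distribution. -/
def stdMoment (p : ℕ) : ℝ := ∫ x, x ^ p ∂(gaussianReal 0 1)

lemma integrable_pow_of_hasGaussianLaw {X : Ω → ℝ} (hX : HasGaussianLaw X P) (p : ℕ) :
    Integrable (fun ω => X ω ^ p) P := by
  have := hX.isProbabilityMeasure
  rcases Nat.eq_zero_or_pos p with rfl | hp
  · simp
  have h : MemLp X p P := hX.memLp (by simp)
  have h1 := h.integrable_norm_pow (by omega)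
  refine h1.mono' (hX.aemeasurable.pow_const p).aestronglyMeasurable ?_
  filter_upwards with ω
  rw [norm_pow]

lemma memLp_pow_of_hasGaussianLaw {X : Ω → ℝ} (hX : HasGaussianLaw X P) (p : ℕ) :
    MemLp (fun ω => X ω ^ p) 2 P := by
  refine (memLp_two_iff_integrable_sq (hX.aemeasurable.pow_const p).aestronglyMeasurable).2 ?_
  simpa [← pow_mul] using integrable_pow_of_hasGaussianLaw hX (p * 2)

lemma integral_even_pow {X : Ω → ℝ} (hX : HasGaussianLaw X P) (h0 : P[X] = 0) (p : ℕ) :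
    ∫ ω, X ω ^ (2 * p) ∂P = Var[X; P] ^ p * stdMoment (2 * p) := by
  have hv := variance_nonneg X P
  have h1 : P.map X = (gaussianReal 0 1).map (fun x => Real.sqrt (Var[X; P]) * x) := by
    rw [hX.map_eq_gaussianReal, h0, gaussianReal_map_const_mul]
    congr 1
    · simp
    · ext; simp [Real.sq_sqrt hv, Real.coe_toNNReal _ hv]
  have h2 : ∫ ω, X ω ^ (2 * p) ∂P = ∫ x, x ^ (2 * p) ∂(P.map X) := by
    rw [integral_map hX.aemeasurable (by fun_prop)]
  rw [h2, h1, integral_map (by fun_prop) (by fun_prop)]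
  simp only [mul_pow, pow_mul, Real.sq_sqrt hv]
  rw [integral_const_mul]
  simp only [← pow_mul]
  rfl

/-- The fourth moment of the standard normal distribution, read off the fourth derivative of its
moment generating function `exp (t ^ 2 / 2)` at the origin. -/
lemma stdMoment_four : stdMoment 4 = 3 := by
  have hmgf : mgf id (gaussianReal 0 1) = fun t => Real.exp (t ^ 2 / 2) := by
    ext t
    rw [mgf_gaussianReal (μ := 0) (v := 1) Measure.map_id]
    norm_num
  have h := iteratedDeriv_mgf_zero (X := id) (μ := gaussianReal 0 1)
    (by rw [integrableExpSet_id_gaussianReal]; simp) 4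
  have hE : ∀ t : ℝ,
      HasDerivAt (fun t : ℝ => Real.exp (t ^ 2 / 2)) (t * Real.exp (t ^ 2 / 2)) t := by
    intro t
    have h1 : HasDerivAt (fun t : ℝ => t ^ 2 / 2) t t :=
      ((hasDerivAt_pow 2 t).div_const 2).congr_deriv (by norm_num)
    exact h1.exp.congr_deriv (mul_comm _ _)
  have step : ∀ q q' : ℝ → ℝ, (∀ t, HasDerivAt q (q' t) t) →
      deriv (fun t => q t * Real.exp (t ^ 2 / 2)) =
        fun t => (q' t + q t * t) * Real.exp (t ^ 2 / 2) := by
    intro q q' hq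
    ext t
    have h1 : HasDerivAt (fun t => q t * Real.exp (t ^ 2 / 2)) _ t := (hq t).mul (hE t)
    rw [h1.deriv]; ring
  have d1 : deriv (fun t : ℝ => Real.exp (t ^ 2 / 2)) = fun t => t * Real.exp (t ^ 2 / 2) := by
    ext t; exact (hE t).deriv
  have d2 : deriv (fun t : ℝ => t * Real.exp (t ^ 2 / 2)) =
      fun t => (1 + t ^ 2) * Real.exp (t ^ 2 / 2) := by
    rw [step (fun t => t) (fun _ => 1) (fun t => hasDerivAt_id t)]
    ext t; ring
  have d3 : deriv (fun t : ℝ => (1 + t ^ 2) * Real.exp (t ^ 2 / 2)) =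
      fun t => (3 * t + t ^ 3) * Real.exp (t ^ 2 / 2) := by
    rw [step (fun t => 1 + t ^ 2) (fun t => 2 * t)
      (fun t => by simpa using (hasDerivAt_pow 2 t).const_add 1)]
    ext t; ring
  have d4 : deriv (fun t : ℝ => (3 * t + t ^ 3) * Real.exp (t ^ 2 / 2)) =
      fun t => (3 + 6 * t ^ 2 + t ^ 4) * Real.exp (t ^ 2 / 2) := by
    rw [step (fun t => 3 * t + t ^ 3) (fun t => 3 + 3 * t ^ 2)
      (fun t => by
        have h1 : HasDerivAt (fun t : ℝ => 3 * t + t ^ 3) _ t :=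
          ((hasDerivAt_id t).const_mul 3).add (hasDerivAt_pow 3 t)
        convert h1 using 1; simp)]
    ext t; ring
  rw [hmgf] at h
  simp only [iteratedDeriv_succ, iteratedDeriv_zero, d1, d2, d3, d4] at h
  simp only [Pi.pow_apply, id] at h
  rw [stdMoment, ← h]; simp

/-- Isserlis' formula `Cov (X ^ 2, Y ^ 2) = 2 Cov (X, Y) ^ 2` for centered jointly Gaussian
variables, obtained from the fourth moments of `X + Y` and `X - Y`. -/
lemma covariance_sq_sq {X Y : Ω → ℝ} (hXY : HasGaussianLaw (fun ω => (X ω, Y ω)) P)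
    (hX0 : P[X] = 0) (hY0 : P[Y] = 0) :
    cov[fun ω => X ω ^ 2, fun ω => Y ω ^ 2; P] = 2 * cov[X, Y; P] ^ 2 := by
  have := hXY.isProbabilityMeasure
  have hX := hXY.fst
  have hY := hXY.snd
  have hadd : HasGaussianLaw (fun ω => X ω + Y ω) P := hXY.fun_add
  have hsub : HasGaussianLaw (fun ω => X ω - Y ω) P := hXY.fun_sub
  have hadd0 : P[fun ω => X ω + Y ω] = 0 := by
    rw [integral_add hX.integrable hY.integrable, hX0, hY0, add_zero]
  have hsub0 : P[fun ω => X ω - Y ω] = 0 := by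
    rw [integral_sub hX.integrable hY.integrable, hX0, hY0, sub_zero]
  have m1 := integral_even_pow hadd hadd0 2
  have m2 := integral_even_pow hsub hsub0 2
  have m3 := integral_even_pow hX hX0 2
  have m4 := integral_even_pow hY hY0 2
  have v1 := integral_even_pow hX hX0 1
  have v2 := integral_even_pow hY hY0 1
  have s2 : stdMoment (2 * 1) = 1 := by
    have := variance_fun_id_gaussianReal (μ := 0) (v := 1)
    rw [variance_of_integral_eq_zero (by fun_prop) (by simp)] at this
    simpa [stdMoment] using this
  rw [stdMoment_four] at m1 m2 m3 m4
  rw [s2] at v1 v2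
  rw [variance_fun_add hX.memLp_two hY.memLp_two] at m1
  rw [variance_fun_sub hX.memLp_two hY.memLp_two] at m2
  have hx2 := memLp_pow_of_hasGaussianLaw hX 2
  have hy2 := memLp_pow_of_hasGaussianLaw hY 2
  have ix := integrable_pow_of_hasGaussianLaw hX 4
  have iy := integrable_pow_of_hasGaussianLaw hY 4
  have ia := integrable_pow_of_hasGaussianLaw hadd 4
  have is := integrable_pow_of_hasGaussianLaw hsub 4
  have ixy : Integrable (fun ω => X ω ^ 2 * Y ω ^ 2) P := hx2.integrable_mul hy2
  have key : ∫ ω, ((X ω + Y ω) ^ 4 + (X ω - Y ω) ^ 4) ∂P =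
      ∫ ω, (2 * X ω ^ 4 + 12 * (X ω ^ 2 * Y ω ^ 2) + 2 * Y ω ^ 4) ∂P := by
    congr 1; ext ω; ring
  rw [integral_add ia is, integral_add (by fun_prop) (by fun_prop),
    integral_add (by fun_prop) (by fun_prop), integral_const_mul, integral_const_mul,
    integral_const_mul] at key
  norm_num at m1 m2 m3 m4 v1 v2
  rw [covariance_eq_sub hx2 hy2]
  simp only [Pi.mul_apply]
  rw [v1, v2]
  rw [m1, m2, m3, m4] at key
  linarith [key]

/-- For a centered, jointly Gaussian family with constant variance and nonnegative correlations,
the variance of the sum of squares is controlled by the variance of the sum. -/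
lemma variance_sum_sq_le {D : ℕ → Ω → ℝ} {v : ℝ} (n : ℕ)
    (hD : ∀ k l, HasGaussianLaw (fun ω => (D k ω, D l ω)) P) (h0 : ∀ k, P[D k] = 0)
    (hv : ∀ k, Var[D k; P] = v) (hc : ∀ k l, 0 ≤ cov[D k, D l; P]) :
    Var[fun ω => ∑ k ∈ Finset.range n, D k ω ^ 2; P] ≤
      2 * v * Var[fun ω => ∑ k ∈ Finset.range n, D k ω; P] := by
  have := (hD 0 0).isProbabilityMeasure
  have hDk : ∀ k, HasGaussianLaw (D k) P := fun k => (hD k k).fst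
  rw [variance_fun_sum' (fun k _ => memLp_pow_of_hasGaussianLaw (hDk k) 2),
    variance_fun_sum' (fun k _ => (hDk k).memLp_two), Finset.mul_sum]
  refine Finset.sum_le_sum fun k _ => ?_
  rw [Finset.mul_sum]
  refine Finset.sum_le_sum fun l _ => ?_
  rw [covariance_sq_sq (hD k l) (h0 k) (h0 l)]
  have h1 := variance_nonneg (fun ω => D k ω - D l ω) P
  rw [variance_fun_sub (hDk k).memLp_two (hDk l).memLp_two, hv, hv] at h1
  have h2 := hc k l
  nlinarith

/-- No independence is assumed: covariances are at most `v` by the Cauchy–Schwarz inequality. -/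
lemma variance_sum_le {D : ℕ → Ω → ℝ} {v : ℝ} (r : ℕ) [IsProbabilityMeasure P]
    (hD : ∀ k, MemLp (D k) 2 P) (hv : ∀ k, Var[D k; P] = v) :
    Var[fun ω => ∑ k ∈ Finset.range r, D k ω; P] ≤ r ^ 2 * v := by
  rw [variance_fun_sum' (fun k _ => hD k)]
  calc _ ≤ ∑ k ∈ Finset.range r, ∑ l ∈ Finset.range r, v := by
        refine Finset.sum_le_sum fun k _ => Finset.sum_le_sum fun l _ => ?_
        have h1 := variance_nonneg (fun ω => D k ω - D l ω) P
        rw [variance_fun_sub (hD k) (hD l), hv, hv] at h1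
        linarith
    _ = _ := by simp; ring

end Gaussian

/-! ### The noise on the observation grid -/

/-- The values `X k = M_{kh}` of the mixed process on the grid: a centered Gaussian sequence whose
covariance is that of `√c₁ B + √c₂ B^H` at integer times. -/
structure IsMixedNoise {Ω : Type*} [MeasurableSpace Ω] (c₁ c₂ H : ℝ) (X : ℕ → Ω → ℝ)
    (P : Measure Ω) : Prop where
  gaussian : IsGaussianProcess X P
  mean : ∀ k, ∫ ω, X k ω ∂P = 0
  covariance : ∀ k l, cov[X k, X l; P] =
    c₁ * (((k : ℝ) + l - |(k : ℝ) - l|) / 2) +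
      c₂ * (((k : ℝ) ^ (2 * H) + (l : ℝ) ^ (2 * H) - |(k : ℝ) - l| ^ (2 * H)) / 2)

/-- The `k`-th increment of length `r` of the sequence `X`, shifted by `s`. -/
def incr {Ω : Type*} (X : ℕ → Ω → ℝ) (r s k : ℕ) (ω : Ω) : ℝ := X (k + s + r) ω - X (k + s) ω

/-- Long and short increments are exchanged by telescoping. -/
lemma sum_incr {Ω : Type*} (X : ℕ → Ω → ℝ) (r s n : ℕ) (ω : Ω) :
    ∑ k ∈ Finset.range n, incr X r s k ω = ∑ u ∈ Finset.range r, incr X n s u ω := by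
  have h1 : ∀ r s n : ℕ, ∑ k ∈ Finset.range n, incr X r s k ω =
      ∑ k ∈ Finset.range n, ∑ u ∈ Finset.range r, incr X 1 s (k + u) ω := by
    intro r s n
    refine Finset.sum_congr rfl fun k _ => ?_
    have := Finset.sum_range_sub (fun u => X (k + s + u) ω) r
    simp only [incr]
    rw [show X (k + s) ω = X (k + s + 0) ω by simp, ← this]
    refine Finset.sum_congr rfl fun u _ => ?_
    congr 2 <;> ring_nf
  rw [h1, h1, Finset.sum_comm]
  simp only [add_comm]

/-- The variance of an increment over `r` steps. -/
def incrVar (c₁ c₂ H : ℝ) (r : ℕ) : ℝ := c₁ * r + c₂ * (r : ℝ) ^ (2 * H)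

namespace IsMixedNoise

variable {Ω : Type*} [MeasurableSpace Ω] {P : Measure Ω} {c₁ c₂ H : ℝ} {X : ℕ → Ω → ℝ}

lemma memLp (h : IsMixedNoise c₁ c₂ H X P) (k : ℕ) : MemLp (X k) 2 P :=
  (h.gaussian.hasGaussianLaw_eval k).memLp_two

lemma hasGaussianLaw_prod_incr (h : IsMixedNoise c₁ c₂ H X P) (r s k l : ℕ) :
    HasGaussianLaw (fun ω => (incr X r s k ω, incr X r s l ω)) P := by
  classical
  set I : Finset ℕ := {k + s + r, k + s, l + s + r, l + s} with hI
  have h1 : k + s + r ∈ I := by simp [hI]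
  have h2 : k + s ∈ I := by simp [hI]
  have h3 : l + s + r ∈ I := by simp [hI]
  have h4 : l + s ∈ I := by simp [hI]
  set π : I → (I → ℝ) →L[ℝ] ℝ := fun i => ContinuousLinearMap.proj i
  exact (h.gaussian.hasGaussianLaw I).map
    ((π ⟨_, h1⟩ - π ⟨_, h2⟩).prod (π ⟨_, h3⟩ - π ⟨_, h4⟩))

lemma hasGaussianLaw_incr (h : IsMixedNoise c₁ c₂ H X P) (r s k : ℕ) :
    HasGaussianLaw (incr X r s k) P := (h.hasGaussianLaw_prod_incr r s k k).fst

lemma integral_incr (h : IsMixedNoise c₁ c₂ H X P) (r s k : ℕ) : P[incr X r s k] = 0 := by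
  have := h.gaussian.isProbabilityMeasure
  simp only [incr]
  rw [integral_sub ((h.memLp _).integrable one_le_two) ((h.memLp _).integrable one_le_two),
    h.mean, h.mean, sub_zero]

lemma covariance_incr (h : IsMixedNoise c₁ c₂ H X P) (r s k l : ℕ) :
    cov[incr X r s k, incr X r s l; P] =
      c₁ * ((|(k : ℝ) - l + r| + |(k : ℝ) - l - r| - 2 * |(k : ℝ) - l|) / 2) +
      c₂ * ((|(k : ℝ) - l + r| ^ (2 * H) + |(k : ℝ) - l - r| ^ (2 * H)
        - 2 * |(k : ℝ) - l| ^ (2 * H)) / 2) := by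
  have := h.gaussian.isProbabilityMeasure
  have e := covariance_fun_sub_fun_sub (h.memLp (k + s + r)) (h.memLp (k + s))
    (h.memLp (l + s + r)) (h.memLp (l + s))
  have e' : cov[incr X r s k, incr X r s l; P] = _ := e
  rw [e']
  simp only [h.covariance]
  push_cast
  rw [show (k : ℝ) + s + r - (l + s + r) = k - l by ring,
    show (k : ℝ) + s + r - (l + s) = k - l + r by ring,
    show (k : ℝ) + s - (l + s + r) = k - l - r by ring,
    show (k : ℝ) + s - (l + s) = k - l by ring]
  ring

lemma variance_incr (h : IsMixedNoise c₁ c₂ H X P) (hH : 0 < H) (r s k : ℕ) :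
    Var[incr X r s k; P] = incrVar c₁ c₂ H r := by
  rw [← covariance_self (h.hasGaussianLaw_incr r s k).aemeasurable, h.covariance_incr, incrVar]
  simp only [sub_self, zero_add, zero_sub, abs_neg, Nat.abs_cast, abs_zero]
  rw [Real.zero_rpow (by positivity)]
  ring

/-- For `H > 1/2` the increments are nonnegatively correlated, by convexity of `x ↦ |x| ^ (2H)`. -/
lemma covariance_incr_nonneg (h : IsMixedNoise c₁ c₂ H X P) (hH : 1 / 2 < H) (h₁ : 0 ≤ c₁)
    (h₂ : 0 ≤ c₂) (r s k l : ℕ) : 0 ≤ cov[incr X r s k, incr X r s l; P] := by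
  rw [h.covariance_incr]
  have key : ∀ p : ℝ, 1 ≤ p → ∀ x r : ℝ,
      0 ≤ |x + r| ^ p + |x - r| ^ p - 2 * |x| ^ p := by
    intro p hp x r
    have h1 : |x| ≤ (|x + r| + |x - r|) / 2 := by
      have := abs_add_le (x + r) (x - r)
      rw [show x + r + (x - r) = 2 * x by ring, abs_mul, abs_two] at this
      linarith
    have h2 := (convexOn_rpow hp).2 (Set.mem_Ici.2 (abs_nonneg (x + r)))
      (Set.mem_Ici.2 (abs_nonneg (x - r))) (by norm_num : (0 : ℝ) ≤ 1 / 2)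
      (by norm_num : (0 : ℝ) ≤ 1 / 2) (by norm_num)
    simp only [smul_eq_mul] at h2
    have h3 : |x| ^ p ≤ (1 / 2 * |x + r| + 1 / 2 * |x - r|) ^ p :=
      Real.rpow_le_rpow (abs_nonneg _) (by linarith) (by linarith)
    linarith
  have k1 := key 1 le_rfl ((k : ℝ) - l) r
  have k2 := key (2 * H) (by linarith) ((k : ℝ) - l) r
  simp only [Real.rpow_one] at k1
  exact add_nonneg (mul_nonneg h₁ (by linarith)) (mul_nonneg h₂ (by linarith))

/-- The empirical second moment of the increments concentrates. As a sum over `k < n` of increments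
of length `r` is also a sum of `r` increments of length `n`, the variance of this sum is of order
`n ^ (2H)`, and that of the empirical second moment is at most of order `n ^ (2H - 2)`. -/
lemma variance_sum_incr_sq_le (h : IsMixedNoise c₁ c₂ H X P) (hH : 1 / 2 < H) (h₁ : 0 ≤ c₁)
    (h₂ : 0 ≤ c₂) (r s n : ℕ) :
    Var[fun ω => ∑ k ∈ Finset.range n, incr X r s k ω ^ 2; P] ≤
      2 * incrVar c₁ c₂ H r * r ^ 2 * incrVar c₁ c₂ H n := by
  have := h.gaussian.isProbabilityMeasure
  have hH0 : 0 < H := by linarith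
  have hv : 0 ≤ incrVar c₁ c₂ H r := by unfold incrVar; positivity
  refine (variance_sum_sq_le n (h.hasGaussianLaw_prod_incr r s) (h.integral_incr r s)
    (h.variance_incr hH0 r s) (h.covariance_incr_nonneg hH h₁ h₂ r s)).trans ?_
  rw [mul_assoc (2 * _)]
  refine mul_le_mul_of_nonneg_left ?_ (by positivity)
  simp only [sum_incr X r s n]
  exact variance_sum_le r (fun u => (h.hasGaussianLaw_incr n s u).memLp_two)
    (h.variance_incr hH0 n s)

end IsMixedNoise

lemma incrVar_le {c₁ c₂ H : ℝ} (hH : 1 / 2 < H) (h₁ : 0 ≤ c₁) (n : ℕ) :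
    incrVar c₁ c₂ H n ≤ (c₁ + c₂) * (n : ℝ) ^ (2 * H) := by
  rcases Nat.eq_zero_or_pos n with rfl | hn
  · simp [incrVar, Real.zero_rpow (by linarith : 2 * H ≠ 0)]
  have h1 : (1 : ℝ) ≤ n := by exact_mod_cast hn
  have : (n : ℝ) ≤ (n : ℝ) ^ (2 * H) := by
    conv_lhs => rw [← Real.rpow_one (n : ℝ)]
    exact Real.rpow_le_rpow_of_exponent_le h1 (by linarith)
  unfold incrVar
  nlinarith

/-- The mixed process on the grid of step `h` is a mixed noise sequence. -/
lemma isMixedNoise_mixedProcess {Ω : Type*} [MeasurableSpace Ω] {P : Measure Ω}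
    [IsProbabilityMeasure P] {σ γ H : ℝ} (h : ℝ≥0) {B BH : ℝ≥0 → Ω → ℝ}
    (hB : IsBrownianReal B P) (hBH : IsFractionalBrownianMotion H BH P)
    (hind : IndepFun (fun ω t => B t ω) (fun ω t => BH t ω) P) :
    IsMixedNoise (σ ^ 2 * h) (γ ^ 2 * (h : ℝ) ^ (2 * H)) H
      (fun k ω => mixedProcess σ γ B BH ((k : ℝ≥0) * h) ω) P := by
  have gB := hB.isGaussianProcess
  have gBH := hBH.gaussian
  have gM : IsGaussianProcess (fun t ω => mixedProcess σ γ B BH t ω) P := by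
    constructor
    intro I
    have hi : IndepFun (fun ω => I.restrict (B · ω)) (fun ω => I.restrict (BH · ω)) P :=
      hind.comp (φ := fun x : ℝ≥0 → ℝ => I.restrict x) (ψ := fun x : ℝ≥0 → ℝ => I.restrict x)
        (Finset.measurable_restrict I) (Finset.measurable_restrict I)
    have hpair := hi.hasGaussianLaw (gB.hasGaussianLaw I) (gBH.hasGaussianLaw I)
    exact hpair.map (σ • ContinuousLinearMap.fst ℝ (I → ℝ) (I → ℝ) +
      γ • ContinuousLinearMap.snd ℝ (I → ℝ) (I → ℝ))
  have m1 : ∀ t, MemLp (B t) 2 P := fun t => (gB.hasGaussianLaw_eval t).memLp_two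
  have m2 : ∀ t, MemLp (BH t) 2 P := fun t => (gBH.hasGaussianLaw_eval t).memLp_two
  refine ⟨gM.comp_right (fun k : ℕ => (k : ℝ≥0) * h), fun k => ?_, fun k l => ?_⟩
  · simp only [mixedProcess]
    rw [integral_add (((m1 _).integrable one_le_two).const_mul σ)
      (((m2 _).integrable one_le_two).const_mul γ), integral_const_mul, integral_const_mul,
      hB.integral_eval, hBH.mean]
    simp
  · have z1 : ∀ s t, cov[B s, BH t; P] = 0 := fun s t =>
      (hind.comp (φ := fun x : ℝ≥0 → ℝ => x s) (ψ := fun x : ℝ≥0 → ℝ => x t)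
        (measurable_pi_apply s) (measurable_pi_apply t)).covariance_eq_zero (m1 s) (m2 t)
    have e : ∀ s t, cov[fun ω => mixedProcess σ γ B BH s ω, fun ω => mixedProcess σ γ B BH t ω; P] =
        σ ^ 2 * cov[B s, B t; P] + γ ^ 2 * cov[BH s, BH t; P] := by
      intro s t
      have f1 : ∀ t, MemLp (σ • B t) 2 P := fun t => (m1 t).const_smul σ
      have f2 : ∀ t, MemLp (γ • BH t) 2 P := fun t => (m2 t).const_smul γ
      have f : ∀ t, (fun ω => mixedProcess σ γ B BH t ω) = σ • B t + γ • BH t := fun t => rfl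
      rw [f, f, covariance_add_left (f1 s) (f2 s) ((f1 t).add (f2 t)),
        covariance_add_right (f1 s) (f1 t) (f2 t), covariance_add_right (f2 s) (f1 t) (f2 t)]
      simp only [covariance_smul_left, covariance_smul_right]
      rw [z1, covariance_comm (BH s) (B t), z1]
      ring
    have e' := e ((k : ℝ≥0) * h) ((l : ℝ≥0) * h)
    refine e'.trans ?_
    rw [hB.covariance_eval, hBH.covariance]
    push_cast
    have hh : (0 : ℝ) ≤ h := h.2
    rw [← sub_mul, abs_mul, abs_of_nonneg hh, Real.mul_rpow (by positivity) hh,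
      Real.mul_rpow (by positivity) hh, Real.mul_rpow (by positivity) hh,
      ← min_mul_of_nonneg _ _ hh]
    have hmin : min (k : ℝ) l = ((k : ℝ) + l - |(k : ℝ) - l|) / 2 := by
      rcases le_total (k : ℝ) l with hkl | hkl
      · rw [min_eq_left hkl, abs_of_nonpos (sub_nonpos.2 hkl)]; ring
      · rw [min_eq_right hkl, abs_of_nonneg (sub_nonneg.2 hkl)]; ring
    rw [hmin, abs_sub_comm (l : ℝ)]
    ring

/-! ### Almost sure convergence of doubly indexed averages -/

section JointConvergence

lemma atTop_prod_atTop_le_cofinite :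
    (atTop : Filter ℕ) ×ˢ (atTop : Filter ℕ) ≤ cofinite := by
  rw [prod_atTop_atTop_eq]; exact atTop_le_cofinite

variable {Ω : Type*} [MeasurableSpace Ω] {P : Measure Ω}

/-- Summable second moments force almost sure convergence to zero along any countable index. -/
lemma ae_tendsto_cofinite_of_summable_sq {ι : Type*} [Countable ι] {U : ι → Ω → ℝ}
    {c : ι → ℝ} (hU : ∀ i, MemLp (U i) 2 P) (hc : ∀ i, ∫ ω, U i ω ^ 2 ∂P ≤ c i)
    (hs : Summable c) : ∀ᵐ ω ∂P, Tendsto (fun i => U i ω) cofinite (𝓝 0) := by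
  have hm : ∀ i, AEMeasurable (fun ω => ENNReal.ofReal (U i ω ^ 2)) P := fun i =>
    ((hU i).aestronglyMeasurable.aemeasurable.pow_const 2).ennreal_ofReal
  have h1 : ∫⁻ ω, ∑' i, ENNReal.ofReal (U i ω ^ 2) ∂P ≠ ⊤ := by
    rw [lintegral_tsum hm]
    refine ne_top_of_le_ne_top hs.tsum_ofReal_ne_top (ENNReal.tsum_le_tsum fun i => ?_)
    rw [← ofReal_integral_eq_lintegral_ofReal (hU i).integrable_sq
      (Eventually.of_forall fun ω => sq_nonneg _)]
    exact ENNReal.ofReal_le_ofReal (hc i)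
  filter_upwards [ae_lt_top' (AEMeasurable.tsum hm) h1] with ω hω
  have h2 := ENNReal.tendsto_cofinite_zero_of_tsum_ne_top hω.ne
  have h3 := (ENNReal.tendsto_toReal ENNReal.zero_ne_top).comp h2
  simp only [Function.comp_def, ENNReal.toReal_ofReal (sq_nonneg _), ENNReal.toReal_zero] at h3
  have h4 := h3.sqrt
  simp only [Real.sqrt_sq_eq_abs, Real.sqrt_zero] at h4
  exact (tendsto_zero_iff_abs_tendsto_zero _).2 h4

/-- The integer part of the `q`-th root. -/
def natRoot (q n : ℕ) : ℕ := Nat.findGreatest (fun k => k ^ q ≤ n) n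

lemma natRoot_pow_le {q : ℕ} (hq : q ≠ 0) (n : ℕ) : natRoot q n ^ q ≤ n :=
  Nat.findGreatest_spec (P := fun k => k ^ q ≤ n) (Nat.zero_le n) (by simp [zero_pow hq])

lemma lt_natRoot_succ_pow {q : ℕ} (hq : q ≠ 0) (n : ℕ) : n < (natRoot q n + 1) ^ q := by
  by_contra h
  push Not at h
  have h1 : natRoot q n + 1 ≤ n := (Nat.le_self_pow hq _).trans h
  have := Nat.le_findGreatest (P := fun k => k ^ q ≤ n) h1 h
  unfold natRoot at this
  omega

lemma tendsto_natRoot {q : ℕ} (hq : q ≠ 0) : Tendsto (natRoot q) atTop atTop := by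
  refine tendsto_atTop.2 fun b => ?_
  filter_upwards [eventually_ge_atTop (b ^ q)] with n hn
  exact Nat.le_findGreatest (P := fun k => k ^ q ≤ n) ((Nat.le_self_pow hq b).trans hn) hn

/-- For nonnegative nondecreasing sequences `S p`, convergence of `S p n / n` along the
subsequence `n = k ^ q` implies convergence along all `n`, uniformly in the parameter `p`. -/
lemma tendsto_div_of_tendsto_pow {ι : Type*} {l : Filter ι} {S : ι → ℕ → ℝ} {w : ι → ℝ} {W : ℝ}
    (hmono : ∀ p, Monotone (S p)) (hpos : ∀ p n, 0 ≤ S p n) (hw : ∀ p, |w p| ≤ W)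
    {q : ℕ} (hq : q ≠ 0)
    (h : Tendsto (fun x : ι × ℕ => S x.1 (x.2 ^ q) / ((x.2 ^ q : ℕ) : ℝ) - w x.1)
      (l ×ˢ atTop) (𝓝 0)) :
    Tendsto (fun x : ι × ℕ => S x.1 x.2 / (x.2 : ℝ) - w x.1) (l ×ˢ atTop) (𝓝 0) := by
  set A : ι × ℕ → ℝ := fun x => S x.1 (x.2 ^ q) / ((x.2 ^ q : ℕ) : ℝ) with hA
  have hroot : Tendsto (fun x : ι × ℕ => natRoot q x.2) (l ×ˢ atTop) atTop :=
    (tendsto_natRoot hq).comp tendsto_snd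
  have hlow : Tendsto (fun x : ι × ℕ => (x.1, natRoot q x.2)) (l ×ˢ atTop) (l ×ˢ atTop) :=
    tendsto_fst.prodMk hroot
  have hupp : Tendsto (fun x : ι × ℕ => (x.1, natRoot q x.2 + 1)) (l ×ˢ atTop) (l ×ˢ atTop) :=
    tendsto_fst.prodMk ((tendsto_add_atTop_nat 1).comp hroot)
  set ρ : ℕ → ℝ := fun k => (1 + 1 / (k : ℝ)) ^ q with hρ
  have hρ1 : Tendsto ρ atTop (𝓝 1) := by
    have := (tendsto_one_div_atTop_nhds_zero_nat (𝕜 := ℝ)).const_add 1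
    simpa [hρ] using this.pow q
  have hρx : Tendsto (fun x : ι × ℕ => ρ (natRoot q x.2)) (l ×ˢ atTop) (𝓝 1) := hρ1.comp hroot
  have bdd : ∀ u : ι × ℕ → ℝ, Tendsto u (l ×ˢ atTop) (𝓝 0) →
      Tendsto (fun x => w x.1 * u x) (l ×ˢ atTop) (𝓝 0) := by
    intro u hu
    refine squeeze_zero_norm (a := fun x => W * |u x|) (fun x => ?_) ?_
    · rw [norm_mul, Real.norm_eq_abs, Real.norm_eq_abs]
      exact mul_le_mul_of_nonneg_right (hw _) (abs_nonneg _)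
    · simpa using hu.abs.const_mul W
  have lim : ∀ (r u : ι × ℕ → ℝ), Tendsto r (l ×ˢ atTop) (𝓝 1) →
      Tendsto (fun x => u x - w x.1) (l ×ˢ atTop) (𝓝 0) →
      Tendsto (fun x => u x * r x - w x.1) (l ×ˢ atTop) (𝓝 0) := by
    intro r u hr hu
    have h1 := bdd (fun x => r x - 1) (by simpa using hr.sub_const 1)
    have h2 := (hu.mul hr).add h1
    simp only [zero_mul, add_zero] at h2
    exact h2.congr fun x => by ring
  -- `S p n / n` lies between its values at the neighbouring `q`-th powers `r ^ q` and
  -- `(r + 1) ^ q`, up to the ratio `ρ r` of these powers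
  have hL := lim (fun x => (ρ (natRoot q x.2))⁻¹) (fun x => A (x.1, natRoot q x.2))
    (by simpa using hρx.inv₀ one_ne_zero) (h.comp hlow)
  have hU := lim (fun x => ρ (natRoot q x.2)) (fun x => A (x.1, natRoot q x.2 + 1))
    hρx (h.comp hupp)
  have hev : ∀ᶠ x : ι × ℕ in l ×ˢ atTop, 0 < natRoot q x.2 := hroot.eventually_gt_atTop 0
  refine tendsto_of_tendsto_of_tendsto_of_le_of_le' hL hU ?_ ?_
  all_goals
    filter_upwards [hev] with x hx
    refine sub_le_sub_right ?_ _
    set r := natRoot q x.2 with hr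
    have h1 : (r ^ q : ℕ) ≤ x.2 := natRoot_pow_le hq x.2
    have h2 : x.2 ≤ (r + 1) ^ q := (lt_natRoot_succ_pow hq x.2).le
    have h1' : ((r ^ q : ℕ) : ℝ) ≤ x.2 := by exact_mod_cast h1
    have h2' : (x.2 : ℝ) ≤ (((r + 1) ^ q : ℕ) : ℝ) := by exact_mod_cast h2
    have hr0 : (0 : ℝ) < r := by exact_mod_cast hx
    have hrq : (0 : ℝ) < ((r ^ q : ℕ) : ℝ) := by push_cast; positivity
    have hrq1 : (0 : ℝ) < (((r + 1) ^ q : ℕ) : ℝ) := by push_cast; positivity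
    have hx0 : (0 : ℝ) < x.2 := hrq.trans_le h1'
    have eρ : ρ r = (((r + 1) ^ q : ℕ) : ℝ) / ((r ^ q : ℕ) : ℝ) := by
      simp only [hρ]; push_cast; rw [← div_pow]; congr 1; field_simp
  · simp only [hA, eρ]
    rw [inv_div, div_mul_div_cancel₀ hrq.ne']
    exact div_le_div₀ (hpos _ _) (hmono _ h1) hx0 h2'
  · simp only [hA, eρ]
    rw [div_mul_div_cancel₀ hrq1.ne']
    exact div_le_div₀ (hpos _ _) (hmono _ h2) hrq h1'

/-- A strong law of large numbers for averages over `i < N` of nonnegative variables `W i j`,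
pairwise independent in `i`, jointly in `N` and `j`: it needs summability in `j` of the
variances only. -/
lemma ae_tendsto_average_sub_mean [IsProbabilityMeasure P] {W : ℕ → ℕ → Ω → ℝ} {w a : ℕ → ℝ}
    {C : ℝ} (hpos : ∀ i j ω, 0 ≤ W i j ω) (hL2 : ∀ i j, MemLp (W i j) 2 P)
    (hind : ∀ j, Pairwise fun i i' => IndepFun (W i j) (W i' j) P)
    (hmean : ∀ i j, P[W i j] = w j) (hw : ∀ j, |w j| ≤ C)
    (hvar : ∀ i j, Var[W i j; P] ≤ a j) (ha : Summable a) :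
    ∀ᵐ ω ∂P, Tendsto (fun x : ℕ × ℕ => (∑ i ∈ Finset.range x.2, W i x.1 ω) / (x.2 : ℝ) - w x.1)
      (atTop ×ˢ atTop) (𝓝 0) := by
  have ha0 : ∀ j, 0 ≤ a j := fun j => (variance_nonneg _ _).trans (hvar 0 j)
  -- along `N = l ^ 2` the variances are summable in `(j, l)`
  set U : ℕ × ℕ → Ω → ℝ := fun x ω => if x.2 = 0 then 0 else
    (∑ i ∈ Finset.range (x.2 ^ 2), W i x.1 ω) / ((x.2 ^ 2 : ℕ) : ℝ) - w x.1 with hU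
  have hsumL2 : ∀ (N j : ℕ), MemLp (fun ω => ∑ i ∈ Finset.range N, W i j ω) 2 P :=
    fun N j => memLp_finsetSum _ fun i _ => hL2 i j
  have hUL2 : ∀ x, MemLp (U x) 2 P := by
    intro x
    by_cases hx : x.2 = 0
    · simp only [hU, hx, if_true]; exact memLp_const 0
    · simp only [hU, hx, if_false, div_eq_mul_inv]
      exact ((hsumL2 _ _).mul_const _).sub (memLp_const _)
  have hUsq : ∀ x, ∫ ω, U x ω ^ 2 ∂P ≤ a x.1 * (1 / (x.2 : ℝ) ^ 2) := by
    rintro ⟨j, l⟩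
    by_cases hl : l = 0
    · simp [hU, hl]
    · have hl0 : (0 : ℝ) < ((l ^ 2 : ℕ) : ℝ) := by
        exact_mod_cast pow_pos (Nat.pos_of_ne_zero hl) 2
      have hsum : P[fun ω => ∑ i ∈ Finset.range (l ^ 2), W i j ω] = ((l ^ 2 : ℕ) : ℝ) * w j := by
        rw [integral_finsetSum _ fun i _ => (hL2 i j).integrable one_le_two]
        simp [hmean]
      have hv : Var[fun ω => ∑ i ∈ Finset.range (l ^ 2), W i j ω; P] ≤ ((l ^ 2 : ℕ) : ℝ) * a j := by
        have e := IndepFun.variance_sum (X := fun i => W i j) (s := Finset.range (l ^ 2)) (μ := P)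
          (fun i _ => hL2 i j) (fun i _ i' _ hii => hind j hii)
        have e2 : (∑ i ∈ Finset.range (l ^ 2), fun ω => W i j ω) =
            fun ω => ∑ i ∈ Finset.range (l ^ 2), W i j ω := by ext ω; simp
        rw [← e2, e]
        calc _ ≤ ∑ i ∈ Finset.range (l ^ 2), a j := Finset.sum_le_sum fun i _ => hvar i j
          _ = _ := by simp
      rw [variance_eq_integral (hsumL2 _ _).aestronglyMeasurable.aemeasurable, hsum] at hv
      have e3 : ∀ ω, U (j, l) ω ^ 2 = (1 / ((l ^ 2 : ℕ) : ℝ) ^ 2) *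
          (∑ i ∈ Finset.range (l ^ 2), W i j ω - ((l ^ 2 : ℕ) : ℝ) * w j) ^ 2 := by
        intro ω
        simp only [hU, hl, if_false]
        rw [div_sub' hl0.ne', div_pow]; ring
      simp only [e3]
      rw [integral_const_mul]
      calc _ ≤ (1 / ((l ^ 2 : ℕ) : ℝ) ^ 2) * (((l ^ 2 : ℕ) : ℝ) * a j) := by gcongr
        _ = _ := by
          have : (l : ℝ) ≠ 0 := by exact_mod_cast hl
          push_cast; field_simp
  have hsummable : Summable fun x : ℕ × ℕ => a x.1 * (1 / (x.2 : ℝ) ^ 2) :=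
    ha.mul_of_nonneg (Real.summable_one_div_nat_pow.2 one_lt_two) ha0
      (fun l => by positivity)
  filter_upwards [ae_tendsto_cofinite_of_summable_sq hUL2 hUsq hsummable] with ω hω
  have h1 : Tendsto (fun x => U x ω) (atTop ×ˢ atTop) (𝓝 0) :=
    hω.mono_left atTop_prod_atTop_le_cofinite
  refine tendsto_div_of_tendsto_pow (S := fun j N => ∑ i ∈ Finset.range N, W i j ω)
    (fun j => ?_) (fun j N => Finset.sum_nonneg fun i _ => hpos i j ω) hw two_ne_zero ?_
  · intro N N' hN
    exact Finset.sum_le_sum_of_subset_of_nonneg (Finset.range_mono hN) fun i _ _ => hpos i j ω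
  · refine h1.congr' ?_
    have : ∀ᶠ x : ℕ × ℕ in atTop ×ˢ atTop, 0 < x.2 := tendsto_snd.eventually_gt_atTop 0
    filter_upwards [this] with x hx
    simp only [hU, hx.ne', if_false]

end JointConvergence

/-! ### Empirical moments of the noise, averaged over the subjects -/

section NoiseAverages

variable {Ω : Type*} [MeasurableSpace Ω] {P : Measure Ω}
  {c₁ c₂ H : ℝ} {X : ℕ → ℕ → Ω → ℝ}

lemma incrVar_nonneg (h₁ : 0 ≤ c₁) (h₂ : 0 ≤ c₂) (r : ℕ) : 0 ≤ incrVar c₁ c₂ H r := by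
  unfold incrVar; positivity

lemma incrVar_div_sq_le (hH : 1 / 2 < H) (h₁ : 0 ≤ c₁) (h₂ : 0 ≤ c₂) (n : ℕ) :
    incrVar c₁ c₂ H n / (n : ℝ) ^ 2 ≤ (c₁ + c₂) * (n : ℝ) ^ (2 * H - 2) := by
  rcases Nat.eq_zero_or_pos n with rfl | hn
  · rw [Nat.cast_zero, zero_pow two_ne_zero, div_zero]; positivity
  have hn' : (0 : ℝ) < n := by exact_mod_cast hn
  rw [Real.rpow_sub hn', ← mul_div_assoc]
  have : (n : ℝ) ^ (2 : ℝ) = (n : ℝ) ^ 2 := by exact_mod_cast Real.rpow_natCast (n : ℝ) 2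
  rw [this]
  exact div_le_div_of_nonneg_right (incrVar_le hH h₁ n) (by positivity)

lemma indepFun_of_noise (hind : iIndepFun (fun i ω k => X i k ω) P) {g : (ℕ → ℝ) → ℝ}
    (hg : Measurable g) : Pairwise fun i i' =>
      IndepFun (fun ω => g fun k => X i k ω) (fun ω => g fun k => X i' k ω) P :=
  fun _ _ hii => (hind.indepFun hii).comp hg hg

/-- The empirical second moments of the increments of the noise, averaged over `N` subjects,
converge almost surely to the variance as the number of observations and `N` tend to infinity
jointly. -/
lemma ae_tendsto_average_incr_sq [IsProbabilityMeasure P]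
    (hX : ∀ i, IsMixedNoise c₁ c₂ H (X i) P)
    (hind : iIndepFun (fun i ω k => X i k ω) P) (hH : H ∈ Set.Ioo (1 / 2 : ℝ) 1)
    (h₁ : 0 ≤ c₁) (h₂ : 0 ≤ c₂) (r s : ℕ) :
    ∀ᵐ ω ∂P, Tendsto (fun p : ℕ × ℕ => average p.2 fun i =>
        (1 / (p.1 : ℝ)) * ∑ k ∈ Finset.range p.1, incr (X i) r s k ω ^ 2)
      (atTop ×ˢ atTop) (𝓝 (incrVar c₁ c₂ H r)) := by
  have hH0 : 0 < H := by linarith [hH.1]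
  set v := incrVar c₁ c₂ H r with hv
  have hv0 : 0 ≤ v := incrVar_nonneg h₁ h₂ r
  -- along `n = j ^ q` the variances of the empirical second moments are summable
  obtain ⟨q, hq⟩ := exists_nat_gt (2 / (2 - 2 * H))
  have hH2 : 0 < 2 - 2 * H := by linarith [hH.2]
  rw [div_lt_iff₀ hH2] at hq
  have hq0 : q ≠ 0 := by rintro rfl; simp at hq; linarith
  set S : ℕ → ℕ → Ω → ℝ := fun i n ω => ∑ k ∈ Finset.range n, incr (X i) r s k ω ^ 2 with hS
  have hSL2 : ∀ i n, MemLp (S i n) 2 P := fun i n =>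
    memLp_finsetSum _ fun k _ => memLp_pow_of_hasGaussianLaw ((hX i).hasGaussianLaw_incr r s k) 2
  have hSmean : ∀ (i n : ℕ), ∫ ω, S i n ω ∂P = (n : ℝ) * v := by
    intro i n
    simp only [hS]
    rw [integral_finsetSum _ fun k _ => (integrable_pow_of_hasGaussianLaw
      ((hX i).hasGaussianLaw_incr r s k) 2)]
    have : ∀ k, ∫ ω, incr (X i) r s k ω ^ 2 ∂P = v := fun k => by
      rw [hv, ← (hX i).variance_incr hH0 r s k, variance_of_integral_eq_zero
        ((hX i).hasGaussianLaw_incr r s k).aemeasurable ((hX i).integral_incr r s k)]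
    simp [this]
  have hSvar : ∀ i n, Var[S i n; P] ≤ 2 * v * r ^ 2 * incrVar c₁ c₂ H n := fun i n =>
    (hX i).variance_sum_incr_sq_le hH.1 h₁ h₂ r s n
  set K := 2 * v * r ^ 2 * (c₁ + c₂) with hK
  have hmain := ae_tendsto_average_sub_mean (P := P)
    (W := fun i j ω => S i (j ^ q) ω * (((j ^ q : ℕ) : ℝ))⁻¹)
    (w := fun j => if j = 0 then 0 else v) (a := fun j => K * (j : ℝ) ^ (q * (2 * H - 2)))
    (C := v) (fun i j ω => mul_nonneg (Finset.sum_nonneg fun k _ => sq_nonneg _) (by positivity))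
    (fun i j => (hSL2 i _).mul_const _) (fun j => ?_) (fun i j => ?_) (fun j => ?_)
    (fun i j => ?_) ?_
  · filter_upwards [hmain] with ω hω
    have h3 := tendsto_div_of_tendsto_pow (l := (atTop : Filter ℕ)) (q := q) (w := fun _ => v)
      (W := v) (S := fun N n => (∑ i ∈ Finset.range N, S i n ω) / (N : ℝ)) (fun N => ?_)
      (fun N n => ?_) (fun _ => (abs_of_nonneg hv0).le) hq0 ?_
    · have h4 := (h3.add_const v).comp
        (tendsto_snd.prodMk tendsto_fst : Tendsto (fun p : ℕ × ℕ => (p.2, p.1))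
          (atTop ×ˢ atTop) (atTop ×ˢ atTop))
      simp only [zero_add] at h4
      refine h4.congr fun p => ?_
      simp only [Function.comp, average, hS, sub_add_cancel]
      rw [← Finset.mul_sum]; field_simp
    · intro n n' hn
      refine div_le_div_of_nonneg_right (Finset.sum_le_sum fun i _ => ?_) (by positivity)
      exact Finset.sum_le_sum_of_subset_of_nonneg (Finset.range_mono hn) fun _ _ _ => sq_nonneg _
    · exact div_nonneg (Finset.sum_nonneg fun i _ => Finset.sum_nonneg fun k _ => sq_nonneg _)
        (by positivity)
    · have h4 := hω.comp
        (tendsto_snd.prodMk tendsto_fst : Tendsto (fun p : ℕ × ℕ => (p.2, p.1))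
          (atTop ×ˢ atTop) (atTop ×ˢ atTop))
      have hev : ∀ᶠ x : ℕ × ℕ in atTop ×ˢ atTop, 0 < x.2 := tendsto_snd.eventually_gt_atTop 0
      refine h4.congr' ?_
      filter_upwards [hev] with x hx
      simp only [Function.comp, hx.ne', if_false]
      rw [← Finset.sum_mul]; field_simp
  · have hg : Measurable fun x : ℕ → ℝ =>
        (∑ k ∈ Finset.range (j ^ q), (x (k + s + r) - x (k + s)) ^ 2) * (((j ^ q : ℕ) : ℝ))⁻¹ := by
      fun_prop
    exact indepFun_of_noise hind hg
  · rw [integral_mul_const, hSmean]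
    by_cases hj : j = 0
    · simp [hj, zero_pow hq0]
    · have : ((j ^ q : ℕ) : ℝ) ≠ 0 := by exact_mod_cast pow_ne_zero q hj
      simp only [hj, if_false]; field_simp
  · split_ifs
    · simpa using hv0
    · exact (abs_of_nonneg hv0).le
  · rw [variance_mul_const]
    have h1 := incrVar_div_sq_le hH.1 h₁ h₂ (j ^ q)
    calc _ ≤ (2 * v * r ^ 2 * incrVar c₁ c₂ H (j ^ q)) * (((j ^ q : ℕ) : ℝ))⁻¹ ^ 2 := by
          gcongr; exact hSvar i _
      _ = 2 * v * r ^ 2 * (incrVar c₁ c₂ H (j ^ q) / ((j ^ q : ℕ) : ℝ) ^ 2) := by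
          rw [inv_pow, div_eq_mul_inv]; ring
      _ ≤ 2 * v * r ^ 2 * ((c₁ + c₂) * ((j ^ q : ℕ) : ℝ) ^ (2 * H - 2)) := by gcongr
      _ = _ := by
          push_cast
          rw [← Real.rpow_natCast (j : ℝ) q, ← Real.rpow_mul (by positivity)]; ring
  · refine Summable.mul_left _ (Real.summable_nat_rpow.2 ?_)
    nlinarith

/-- The even moments of the time-averaged noise decay polynomially, as fast as desired if their
order is large. -/
lemma integral_incr_div_pow_le {Y : ℕ → Ω → ℝ} (hY : IsMixedNoise c₁ c₂ H Y P) (hH : 1 / 2 < H)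
    (h₁ : 0 ≤ c₁) (h₂ : 0 ≤ c₂) (s p n : ℕ) :
    ∫ ω, (incr Y n s 0 ω / n) ^ (2 * p) ∂P ≤
      (c₁ + c₂) ^ p * stdMoment (2 * p) * (n : ℝ) ^ (p * (2 * H - 2)) := by
  have hm0 : 0 ≤ stdMoment (2 * p) := integral_nonneg fun x => by
    simp only [pow_mul]; positivity
  simp only [div_pow]
  rw [integral_div, integral_even_pow (hY.hasGaussianLaw_incr n s 0) (hY.integral_incr n s 0),
    hY.variance_incr (by linarith)]
  calc incrVar c₁ c₂ H n ^ p * stdMoment (2 * p) / (n : ℝ) ^ (2 * p)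
      = (incrVar c₁ c₂ H n / (n : ℝ) ^ 2) ^ p * stdMoment (2 * p) := by
        rw [div_pow, pow_mul]; ring
    _ ≤ ((c₁ + c₂) * (n : ℝ) ^ (2 * H - 2)) ^ p * stdMoment (2 * p) := by
        refine mul_le_mul_of_nonneg_right (pow_le_pow_left₀ ?_ (incrVar_div_sq_le hH h₁ h₂ n) p) hm0
        exact div_nonneg (incrVar_nonneg h₁ h₂ n) (by positivity)
    _ = _ := by
        rw [mul_pow, ← Real.rpow_natCast ((n : ℝ) ^ (2 * H - 2)), ← Real.rpow_mul (by positivity)]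
        ring_nf

/-- The squared time-averaged noise, averaged over `N` subjects, vanishes jointly in the limit. -/
lemma ae_tendsto_average_sq_mean_incr [IsProbabilityMeasure P]
    (hX : ∀ i, IsMixedNoise c₁ c₂ H (X i) P)
    (hind : iIndepFun (fun i ω k => X i k ω) P) (hH : H ∈ Set.Ioo (1 / 2 : ℝ) 1)
    (h₁ : 0 ≤ c₁) (h₂ : 0 ≤ c₂) (s : ℕ) :
    ∀ᵐ ω ∂P, Tendsto (fun p : ℕ × ℕ => average p.2 fun i => (incr (X i) p.1 s 0 ω / p.1) ^ 2)
      (atTop ×ˢ atTop) (𝓝 0) := by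
  have hH0 : 0 < H := by linarith [hH.1]
  have hH2 : 0 < 2 - 2 * H := by linarith [hH.2]
  -- the moments of order `2 p` and `4 p` of the time-averaged noise are summable in `n`, and
  -- the power mean inequality returns from the power `2 p` to the square
  obtain ⟨p, hp⟩ := exists_nat_gt (1 / (2 - 2 * H))
  rw [div_lt_iff₀ hH2] at hp
  have hp0 : p ≠ 0 := by rintro rfl; simp at hp; linarith
  have hg : ∀ i n, HasGaussianLaw (incr (X i) n s 0) P := fun i n =>
    (hX i).hasGaussianLaw_incr n s 0
  set w : ℕ → ℝ := fun n => (incrVar c₁ c₂ H n / (n : ℝ) ^ 2) ^ p * stdMoment (2 * p) with hw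
  have hwmean : ∀ i n, ∫ ω, (incr (X i) n s 0 ω / n) ^ (2 * p) ∂P = w n := by
    intro i n
    simp only [div_pow, hw]
    rw [integral_div, integral_even_pow (hg i n) ((hX i).integral_incr n s 0),
      (hX i).variance_incr hH0, pow_mul]
    ring
  have hw0 : ∀ n, 0 ≤ w n := fun n => by
    rw [← hwmean 0 n]; exact integral_nonneg fun ω => by simp only [pow_mul]; positivity
  have hwle : ∀ n, w n ≤ (c₁ + c₂) ^ p * stdMoment (2 * p) * (n : ℝ) ^ (p * (2 * H - 2)) :=
    fun n => by rw [← hwmean 0 n]; exact integral_incr_div_pow_le (hX 0) hH.1 h₁ h₂ s p n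
  have hsum : Summable fun n : ℕ => (n : ℝ) ^ (p * (2 * H - 2)) := by
    refine Real.summable_nat_rpow.2 ?_
    nlinarith
  have hsum2 : Summable fun n : ℕ => (n : ℝ) ^ (((2 * p : ℕ) : ℝ) * (2 * H - 2)) := by
    refine Real.summable_nat_rpow.2 ?_
    push_cast; nlinarith
  have hwlim : Tendsto w atTop (𝓝 0) := by
    refine squeeze_zero hw0 hwle ?_
    simpa using hsum.tendsto_atTop_zero.const_mul ((c₁ + c₂) ^ p * stdMoment (2 * p))
  obtain ⟨C, hC⟩ := hwlim.abs.bddAbove_range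
  have hmain := ae_tendsto_average_sub_mean (P := P)
    (W := fun i n ω => (incr (X i) n s 0 ω / n) ^ (2 * p)) (w := w)
    (a := fun n => (c₁ + c₂) ^ (2 * p) * stdMoment (2 * (2 * p)) *
      (n : ℝ) ^ (((2 * p : ℕ) : ℝ) * (2 * H - 2))) (C := C)
    (fun i n ω => by simp only [pow_mul]; positivity)
    (fun i n => ?_) (fun n => ?_) hwmean (fun n => hC ⟨n, rfl⟩) (fun i n => ?_)
    (hsum2.mul_left _)
  · filter_upwards [hmain] with ω hω
    have h1 := hω.add (hwlim.comp (tendsto_fst : Tendsto Prod.fst (atTop ×ˢ atTop : Filter (ℕ × ℕ))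
      atTop))
    simp only [add_zero, Function.comp, sub_add_cancel] at h1
    have h2 : Tendsto (fun x : ℕ × ℕ => (average x.2 fun i => (incr (X i) x.1 s 0 ω / x.1) ^ 2) ^ p)
        (atTop ×ˢ atTop) (𝓝 0) := by
      refine tendsto_of_tendsto_of_tendsto_of_le_of_le' tendsto_const_nhds h1 ?_ ?_
      · filter_upwards with x
        have : 0 ≤ average x.2 fun i => (incr (X i) x.1 s 0 ω / x.1) ^ 2 := by
          unfold average; positivity
        positivity
      · have hev : ∀ᶠ x : ℕ × ℕ in atTop ×ˢ atTop, 0 < x.2 := tendsto_snd.eventually_gt_atTop 0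
        filter_upwards [hev] with x hx
        have hx' : (x.2 : ℝ) ≠ 0 := by exact_mod_cast hx.ne'
        have := Real.pow_arith_mean_le_arith_mean_pow (Finset.range x.2) (fun _ => 1 / (x.2 : ℝ))
          (fun i => (incr (X i) x.1 s 0 ω / x.1) ^ 2) (fun _ _ => by positivity)
          (by simp; field_simp) (fun _ _ => sq_nonneg _) p
        simp only [← Finset.mul_sum, ← pow_mul] at this
        unfold average
        refine this.trans (le_of_eq ?_)
        rw [one_div, mul_comm, div_eq_mul_inv]
    have h3 := h2.rpow_const (p := (p : ℝ)⁻¹) (Or.inr (by positivity))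
    rw [Real.zero_rpow (inv_ne_zero (by exact_mod_cast hp0))] at h3
    refine h3.congr fun x => ?_
    rw [Real.pow_rpow_inv_natCast _ hp0]
    unfold average; positivity
  · simp only [div_pow]
    simp only [div_eq_mul_inv]
    exact (memLp_pow_of_hasGaussianLaw (hg i n) (2 * p)).mul_const _
  · have hgm : Measurable fun x : ℕ → ℝ => ((x (0 + s + n) - x (0 + s)) / n) ^ (2 * p) := by
      fun_prop
    exact indepFun_of_noise hind hgm
  · refine (variance_le_expectation_sq ?_).trans ?_
    · exact (((hg i n).aemeasurable.div_const _).pow_const _).aestronglyMeasurable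
    · refine le_trans (le_of_eq ?_) (integral_incr_div_pow_le (hX i) hH.1 h₁ h₂ s (2 * p) n)
      congr 1; ext ω
      simp only [Pi.pow_apply, ← pow_mul]; ring

end NoiseAverages

/-! ### Consistency of the estimator of `σ²` -/

section Average

lemma average_add (N : ℕ) (u v : ℕ → ℝ) :
    average N (fun i => u i + v i) = average N u + average N v := by
  simp [average, Finset.sum_add_distrib, mul_add]

lemma average_const_mul (N : ℕ) (c : ℝ) (u : ℕ → ℝ) :
    average N (fun i => c * u i) = c * average N u := by
  simp only [average, ← Finset.mul_sum]; ring

lemma average_sub (N : ℕ) (u v : ℕ → ℝ) :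
    average N (fun i => u i - v i) = average N u - average N v := by
  simp [average, Finset.sum_sub_distrib, mul_sub]

lemma average_mono {N : ℕ} {u v : ℕ → ℝ} (h : ∀ i < N, u i ≤ v i) : average N u ≤ average N v := by
  unfold average
  exact mul_le_mul_of_nonneg_left (Finset.sum_le_sum fun i hi => h i (Finset.mem_range.1 hi))
    (by positivity)

lemma average_congr {N : ℕ} {u v : ℕ → ℝ} (h : ∀ i < N, u i = v i) : average N u = average N v := by
  unfold average
  rw [Finset.sum_congr rfl fun i hi => h i (Finset.mem_range.1 hi)]

lemma average_const {N : ℕ} (hN : N ≠ 0) (c : ℝ) : average N (fun _ => c) = c := by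
  have : (N : ℝ) ≠ 0 := by exact_mod_cast hN
  simp [average]; field_simp

/-- With bounded weights, averages of `a u` are controlled by averages of `u ^ 2`. -/
lemma sq_average_mul_le {N : ℕ} (hN : N ≠ 0) {a u : ℕ → ℝ} {A : ℝ} (ha : ∀ i, |a i| ≤ A) :
    (average N fun i => a i * u i) ^ 2 ≤ A ^ 2 * average N fun i => u i ^ 2 := by
  have hN' : (0 : ℝ) < N := by exact_mod_cast Nat.pos_of_ne_zero hN
  have h := Finset.sum_mul_sq_le_sq_mul_sq (Finset.range N) a u
  have h2 : ∑ i ∈ Finset.range N, a i ^ 2 ≤ N * A ^ 2 := by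
    calc _ ≤ ∑ i ∈ Finset.range N, A ^ 2 := Finset.sum_le_sum fun i _ => by
          rw [← sq_abs]; exact pow_le_pow_left₀ (abs_nonneg _) (ha i) 2
      _ = _ := by simp
  have h3 : 0 ≤ ∑ i ∈ Finset.range N, u i ^ 2 := Finset.sum_nonneg fun i _ => sq_nonneg _
  unfold average
  calc _ = (1 / (N : ℝ)) ^ 2 * (∑ i ∈ Finset.range N, a i * u i) ^ 2 := by rw [mul_pow]
    _ ≤ (1 / (N : ℝ)) ^ 2 * ((N * A ^ 2) * ∑ i ∈ Finset.range N, u i ^ 2) := by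
        gcongr; exact h.trans (mul_le_mul_of_nonneg_right h2 h3)
    _ = _ := by field_simp

lemma tendsto_average_mul {ι : Type*} {l : Filter ι} {N : ι → ℕ} (hN : ∀ᶠ p in l, N p ≠ 0)
    {a : ℕ → ℝ} {A : ℝ} (ha : ∀ i, |a i| ≤ A) {u : ι → ℕ → ℝ}
    (hu : Tendsto (fun p => average (N p) fun i => u p i ^ 2) l (𝓝 0)) :
    Tendsto (fun p => average (N p) fun i => a i * u p i) l (𝓝 0) := by
  have h1 : Tendsto (fun p => (average (N p) fun i => a i * u p i) ^ 2) l (𝓝 0) := by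
    refine tendsto_of_tendsto_of_tendsto_of_le_of_le' tendsto_const_nhds
      (by simpa using hu.const_mul (A ^ 2)) (Eventually.of_forall fun p => sq_nonneg _) ?_
    filter_upwards [hN] with p hp using sq_average_mul_le hp ha
  have h4 := h1.sqrt
  simp only [Real.sqrt_sq_eq_abs, Real.sqrt_zero] at h4
  exact (tendsto_zero_iff_abs_tendsto_zero _).2 h4

end Average

section Subject

/-- The mean over time of the squared increments of length `r`, shifted by `s`. -/
def meanIncrSq {Ω : Type*} (X : ℕ → Ω → ℝ) (r s n : ℕ) (ω : Ω) : ℝ :=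
  (1 / (n : ℝ)) * ∑ k ∈ Finset.range n, incr X r s k ω ^ 2

/-- The mean over time of the unit increments, shifted by `s`; the sum is written in its telescoped
form. -/
def meanIncr {Ω : Type*} (X : ℕ → Ω → ℝ) (s n : ℕ) (ω : Ω) : ℝ := incr X n s 0 ω / n

variable {Ω : Type*} {X : ℕ → Ω → ℝ} {ω : Ω} {a h : ℝ} {y : ℕ → ℝ}

lemma sum_incr_one (X : ℕ → Ω → ℝ) (s n : ℕ) (ω : Ω) :
    ∑ k ∈ Finset.range n, incr X 1 s k ω = incr X n s 0 ω := by
  rw [sum_incr]; simp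

lemma thetaHat_eq (hy : ∀ k, y k = a * (k * h) + X k ω) (hh : h ≠ 0) {n : ℕ} (hn : n ≠ 0) :
    thetaHat h n y = a + meanIncr X 0 n ω / h := by
  have hn' : (n : ℝ) ≠ 0 := by exact_mod_cast hn
  rw [thetaHat, Finset.sum_range_sub y n, hy, hy, meanIncr, incr]
  simp only [zero_add, add_zero, Nat.cast_zero, zero_mul, mul_zero]
  field_simp
  ring

/-- The statistics of a subject differ from the noise statistics by terms which are quadratic in
the trend; subtracting the squared estimated trend removes the quadratic part. -/
lemma xi_sub (hy : ∀ k, y k = a * (k * h) + X k ω) (hh : h ≠ 0) {n : ℕ} (hn : n ≠ 0) :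
    xi n y - h ^ 2 * thetaHat h n y ^ 2 = meanIncrSq X 1 0 n ω - meanIncr X 0 n ω ^ 2 := by
  have hn' : (n : ℝ) ≠ 0 := by exact_mod_cast hn
  have e : ∀ k, (y (k + 1) - y k) ^ 2 =
      incr X 1 0 k ω ^ 2 + (a * h) ^ 2 + 2 * (a * h) * incr X 1 0 k ω := by
    intro k
    rw [hy, hy, incr]; push_cast; simp only [add_zero]; ring
  rw [thetaHat_eq hy hh hn, xi]
  simp only [e, Finset.sum_add_distrib, ← Finset.mul_sum, sum_incr_one]
  rw [meanIncrSq, meanIncr]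
  simp only [Finset.sum_const, Finset.card_range, nsmul_eq_mul]
  field_simp
  ring

lemma eta_sub (hy : ∀ k, y k = a * (k * h) + X k ω) (hh : h ≠ 0) {n : ℕ} (hn : n ≠ 0) :
    eta n y - h ^ 2 * thetaHat h n y ^ 2 =
      (1 / 2) * (meanIncrSq X 2 0 n ω - meanIncrSq X 1 0 n ω - meanIncrSq X 1 1 n ω) +
        (h * (a * meanIncr X 1 n ω) - h * (a * meanIncr X 0 n ω)) - meanIncr X 0 n ω ^ 2 := by
  have hn' : (n : ℝ) ≠ 0 := by exact_mod_cast hn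
  have e : ∀ k, (y (k + 1) - y k) * (y (k + 2) - y (k + 1)) =
      (1 / 2) * (incr X 2 0 k ω ^ 2 - incr X 1 0 k ω ^ 2 - incr X 1 1 k ω ^ 2) + (a * h) ^ 2 +
        (a * h) * (incr X 1 0 k ω + incr X 1 1 k ω) := by
    intro k
    simp only [hy, incr]; push_cast; simp only [add_zero, add_assoc, Nat.reduceAdd]; ring
  rw [thetaHat_eq hy hh hn, eta]
  simp only [e, Finset.sum_add_distrib, ← Finset.mul_sum, Finset.sum_sub_distrib, sum_incr_one]
  simp only [meanIncrSq, meanIncr]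
  simp only [Finset.sum_const, Finset.card_range, nsmul_eq_mul]
  field_simp
  ring

lemma zeta_sub (hy : ∀ k, y k = a * (k * h) + X k ω) (hh : h ≠ 0) {n : ℕ} (hn : n ≠ 0) :
    zeta n y - 4 * h ^ 2 * thetaHat h n y ^ 2 =
      (1 / 2) * (meanIncrSq X 4 0 n ω - meanIncrSq X 2 0 n ω - meanIncrSq X 2 2 n ω) +
        (2 * h) * ((a * meanIncr X 1 n ω + a * meanIncr X 2 n ω + a * meanIncr X 3 n ω) -
          3 * (a * meanIncr X 0 n ω)) - 4 * meanIncr X 0 n ω ^ 2 := by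
  have hn' : (n : ℝ) ≠ 0 := by exact_mod_cast hn
  have e : ∀ k, (y (k + 2) - y k) * (y (k + 4) - y (k + 2)) =
      (1 / 2) * (incr X 4 0 k ω ^ 2 - incr X 2 0 k ω ^ 2 - incr X 2 2 k ω ^ 2) + 4 * (a * h) ^ 2 +
        2 * (a * h) * (incr X 1 0 k ω + incr X 1 1 k ω + incr X 1 2 k ω + incr X 1 3 k ω) := by
    intro k
    simp only [hy, incr]; push_cast; simp only [add_zero, add_assoc, Nat.reduceAdd]; ring
  rw [thetaHat_eq hy hh hn, zeta]
  simp only [e, Finset.sum_add_distrib, ← Finset.mul_sum, Finset.sum_sub_distrib, sum_incr_one]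
  simp only [meanIncrSq, meanIncr]
  simp only [Finset.sum_const, Finset.card_range, nsmul_eq_mul]
  field_simp
  ring

end Subject

/-- Consistency of `σ̂²`, given the joint limits of the averaged noise statistics. -/
lemma tendsto_sigmaSqHat {Ω : Type*} {X : ℕ → ℕ → Ω → ℝ} {ω : Ω} {a : ℕ → ℝ} {A σ γ H h : ℝ}
    (hh : 0 < h) (hγ : 0 < γ) (hH : 1 / 2 < H) (ha : ∀ i, |a i| ≤ A) {y : ℕ → ℕ → ℝ}
    (hy : ∀ i k, y i k = a i * (k * h) + X i k ω)
    (hq : ∀ r s, Tendsto (fun p : ℕ × ℕ => average p.2 fun i => meanIncrSq (X i) r s p.1 ω)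
      (atTop ×ˢ atTop) (𝓝 (incrVar (σ ^ 2 * h) (γ ^ 2 * h ^ (2 * H)) H r)))
    (ht : ∀ s, Tendsto (fun p : ℕ × ℕ => average p.2 fun i => meanIncr (X i) s p.1 ω ^ 2)
      (atTop ×ˢ atTop) (𝓝 0)) :
    Tendsto (fun p : ℕ × ℕ => sigmaSqHat h p.1 p.2 y) (atTop ×ˢ atTop) (𝓝 (σ ^ 2)) := by
  set c₂ := γ ^ 2 * h ^ (2 * H) with hc₂
  have hn0 : ∀ᶠ p : ℕ × ℕ in atTop ×ˢ atTop, p.1 ≠ 0 := tendsto_fst.eventually_ne_atTop 0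
  have hN0 : ∀ᶠ p : ℕ × ℕ in atTop ×ˢ atTop, p.2 ≠ 0 := tendsto_snd.eventually_ne_atTop 0
  have hat : ∀ s, Tendsto (fun p : ℕ × ℕ => average p.2 fun i => a i * meanIncr (X i) s p.1 ω)
      (atTop ×ˢ atTop) (𝓝 0) := fun s => tendsto_average_mul hN0 ha (ht s)
  have hc₂pos : 0 < c₂ := by positivity
  have hden : 0 < (2 : ℝ) ^ (2 * H - 1) - 1 := by
    have : (1 : ℝ) < 2 ^ (2 * H - 1) := Real.one_lt_rpow (by norm_num) (by linarith)
    linarith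
  have e2 : (2 : ℝ) ^ (2 * H) = 2 * 2 ^ (2 * H - 1) := by
    rw [Real.rpow_sub_one (by norm_num)]; ring
  have e4 : (4 : ℝ) ^ (2 * H) = 2 ^ (2 * H) * 2 ^ (2 * H) := by
    rw [← Real.mul_rpow (by norm_num) (by norm_num)]; norm_num
  -- by polarization, `ξ`, `η`, `ζ` have limits which are differences of increment variances
  have hxi : Tendsto (fun p : ℕ × ℕ => (average p.2 fun i => xi p.1 (y i)) -
      h ^ 2 * vBar h p.1 p.2 y) (atTop ×ˢ atTop) (𝓝 (σ ^ 2 * h + c₂)) := by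
    have hlim := (hq 1 0).sub (ht 0)
    have e : incrVar (σ ^ 2 * h) c₂ H 1 - 0 = σ ^ 2 * h + c₂ := by simp [incrVar]
    rw [e] at hlim
    refine hlim.congr' ?_
    filter_upwards [hn0] with p hp
    rw [vBar, ← average_const_mul, ← average_sub, ← average_sub]
    exact average_congr fun i _ => (xi_sub (hy i) hh.ne' hp).symm
  have heta : Tendsto (fun p : ℕ × ℕ => (average p.2 fun i => eta p.1 (y i)) -
      h ^ 2 * vBar h p.1 p.2 y) (atTop ×ˢ atTop) (𝓝 (c₂ * (2 ^ (2 * H - 1) - 1))) := by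
    have hlim := (((((hq 2 0).sub (hq 1 0)).sub (hq 1 1)).const_mul (1 / 2)).add
      (((hat 1).const_mul h).sub ((hat 0).const_mul h))).sub (ht 0)
    have e : (1 / 2) * (incrVar (σ ^ 2 * h) c₂ H 2 - incrVar (σ ^ 2 * h) c₂ H 1 -
        incrVar (σ ^ 2 * h) c₂ H 1) + (h * 0 - h * 0) - 0 = c₂ * (2 ^ (2 * H - 1) - 1) := by
      simp only [incrVar]; push_cast; rw [e2, Real.one_rpow]; ring
    rw [e] at hlim
    refine hlim.congr' ?_
    filter_upwards [hn0] with p hp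
    have := average_congr (N := p.2) fun i _ => eta_sub (hy i) hh.ne' hp
    simp only [average_add, average_sub, average_const_mul] at this
    exact this.symm
  have hzeta : Tendsto (fun p : ℕ × ℕ => (average p.2 fun i => zeta p.1 (y i)) -
      4 * h ^ 2 * vBar h p.1 p.2 y) (atTop ×ˢ atTop)
      (𝓝 (2 ^ (2 * H) * (c₂ * (2 ^ (2 * H - 1) - 1)))) := by
    have hlim := (((((hq 4 0).sub (hq 2 0)).sub (hq 2 2)).const_mul (1 / 2)).add
      (((((hat 1).add (hat 2)).add (hat 3)).sub ((hat 0).const_mul 3)).const_mul (2 * h))).sub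
      ((ht 0).const_mul 4)
    have e : (1 / 2) * (incrVar (σ ^ 2 * h) c₂ H 4 - incrVar (σ ^ 2 * h) c₂ H 2 -
        incrVar (σ ^ 2 * h) c₂ H 2) + 2 * h * (0 + 0 + 0 - 3 * 0) - 4 * 0 =
        2 ^ (2 * H) * (c₂ * (2 ^ (2 * H - 1) - 1)) := by
      simp only [incrVar]; push_cast; rw [e4, e2]; ring
    rw [e] at hlim
    refine hlim.congr' ?_
    filter_upwards [hn0] with p hp
    have := average_congr (N := p.2) fun i _ => zeta_sub (hy i) hh.ne' hp
    simp only [average_add, average_sub, average_const_mul] at this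
    exact this.symm
  have hpow : (0 : ℝ) < 2 ^ (2 * H) := by positivity
  have hne : c₂ * ((2 : ℝ) ^ (2 * H - 1) - 1) ≠ 0 := by positivity
  -- the argument of `log₂⁺` tends to `2 ^ (2H) > 0`, where `log₂⁺` is continuous
  have hhurst : Tendsto (fun p : ℕ × ℕ => hurstHat h p.1 p.2 y) (atTop ×ˢ atTop) (𝓝 H) := by
    have hratio := hzeta.div heta hne
    rw [mul_div_cancel_right₀ _ hne] at hratio
    have hlog : Tendsto logTwoPlus (𝓝 ((2 : ℝ) ^ (2 * H))) (𝓝 (2 * H)) := by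
      have h1 : Tendsto (Real.logb 2) (𝓝 ((2 : ℝ) ^ (2 * H))) (𝓝 (2 * H)) := by
        have := (Real.continuousAt_logb (b := 2) hpow.ne').tendsto
        rwa [Real.logb_rpow (by norm_num) (by norm_num)] at this
      refine h1.congr' ?_
      filter_upwards [lt_mem_nhds hpow] with x hx
      simp [logTwoPlus, hx]
    have := (hlog.comp hratio).const_mul (1 / 2)
    rw [show 1 / 2 * (2 * H) = H by ring] at this
    exact this
  have h2H := hhurst.const_mul 2
  have hhp : Tendsto (fun p : ℕ × ℕ => h ^ (2 * hurstHat h p.1 p.2 y)) (atTop ×ˢ atTop)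
      (𝓝 (h ^ (2 * H))) :=
    (Real.continuousAt_const_rpow hh.ne').tendsto.comp h2H
  have h2p : Tendsto (fun p : ℕ × ℕ => (2 : ℝ) ^ (2 * hurstHat h p.1 p.2 y - 1)) (atTop ×ˢ atTop)
      (𝓝 (2 ^ (2 * H - 1))) :=
    (Real.continuousAt_const_rpow two_ne_zero).tendsto.comp (h2H.sub_const 1)
  have hhpos : 0 < h ^ (2 * H) := by positivity
  have hgamma : Tendsto (fun p : ℕ × ℕ => gammaSqHat h p.1 p.2 y) (atTop ×ˢ atTop)
      (𝓝 (γ ^ 2)) := by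
    have := heta.div (hhp.mul (h2p.sub_const 1)) (by positivity)
    have e : c₂ * (2 ^ (2 * H - 1) - 1) / (h ^ (2 * H) * (2 ^ (2 * H - 1) - 1)) = γ ^ 2 := by
      rw [hc₂]; field_simp
    rw [e] at this
    exact this
  have := (hxi.sub (hgamma.mul hhp)).div_const h
  have e : (σ ^ 2 * h + c₂ - γ ^ 2 * h ^ (2 * H)) / h = σ ^ 2 := by
    rw [hc₂]; field_simp; ring
  rw [e] at this
  exact this

/-! ### Uniform deviations of empirical distribution functions -/

/-- The empirical distribution function of `z 0, …, z (N - 1)`. -/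
def ecdf (N : ℕ) (z : ℕ → ℝ) (x : ℝ) : ℝ := average N fun i => if z i ≤ x then 1 else 0

lemma ecdf_mono (N : ℕ) (z : ℕ → ℝ) : Monotone (ecdf N z) := by
  intro x y hxy
  refine average_mono fun i _ => ?_
  split_ifs with h1 h2
  · exact le_rfl
  · exact absurd (h1.trans hxy) h2
  · exact zero_le_one
  · exact le_rfl

/-- A monotone function close to a Lipschitz function on a grid is close to it between the grid
points. -/
lemma abs_sub_le_of_grid {E G : ℝ → ℝ} {K ε : ℝ} {N : ℕ} (hN : N ≠ 0) (hE : Monotone E)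
    (hG : ∀ x y, |G x - G y| ≤ K * |x - y|)
    (h : ∀ k ∈ Finset.Icc (-(3 * N : ℤ)) (3 * N + 1), |E (k / N) - G (k / N)| ≤ ε)
    {y : ℝ} (hy : |y| ≤ 3) : |E y - G y| ≤ ε + K / N := by
  have hN' : (0 : ℝ) < N := by exact_mod_cast Nat.pos_of_ne_zero hN
  rw [abs_le] at hy
  set k := ⌊y * N⌋ with hk
  have h1 : (k : ℝ) ≤ y * N := Int.floor_le _
  have h2 : y * N < k + 1 := Int.lt_floor_add_one _
  have hk1 : -(3 * N : ℤ) ≤ k := by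
    rw [hk, Int.le_floor]; push_cast; nlinarith
  have hk2 : k ≤ 3 * N := by
    have : (k : ℝ) ≤ ((3 * N : ℤ) : ℝ) := by push_cast; nlinarith
    exact_mod_cast this
  have g1 := h k (Finset.mem_Icc.2 ⟨hk1, by omega⟩)
  have g2 := h (k + 1) (Finset.mem_Icc.2 ⟨by omega, by omega⟩)
  push_cast at g2
  have b1 : (k : ℝ) / N ≤ y := by rwa [div_le_iff₀ hN']
  have b2 : y ≤ ((k : ℝ) + 1) / N := by rw [le_div_iff₀ hN']; exact h2.le
  have e1 := hE b1
  have e2 := hE b2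
  have hK : 0 ≤ K := by
    have := (abs_nonneg _).trans (hG 1 0)
    simpa using this
  have l1 : |G (k / N) - G y| ≤ K / N := by
    refine (hG _ _).trans ?_
    rw [div_eq_mul_one_div K]
    refine mul_le_mul_of_nonneg_left ?_ hK
    rw [abs_of_nonpos (sub_nonpos.2 b1)]
    rw [add_div] at b2
    linarith
  have l2 : |G ((k + 1) / N) - G y| ≤ K / N := by
    refine (hG _ _).trans ?_
    rw [div_eq_mul_one_div K]
    refine mul_le_mul_of_nonneg_left ?_ hK
    rw [abs_of_nonneg (by linarith)]
    rw [add_div]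
    linarith
  rw [abs_le] at *
  constructor <;> linarith [g1.1, g2.2, l1.1, l1.2, l2.1, l2.2]

section Probability

variable {Ω : Type*} [MeasurableSpace Ω] {P : Measure Ω}

lemma integral_ite_le_eq_measureReal {Z : Ω → ℝ} (hZ : Measurable Z) (x : ℝ) :
    ∫ ω, (if Z ω ≤ x then 1 else 0 : ℝ) ∂P = P.real {ω | Z ω ≤ x} := by
  have : (fun ω => (if Z ω ≤ x then 1 else 0 : ℝ)) = Set.indicator {ω | Z ω ≤ x} 1 := by
    ext ω; simp [Set.indicator]
  rw [this, integral_indicator_one (measurableSet_le hZ measurable_const)]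

/-- Hoeffding's inequality for the empirical distribution function at a point. -/
lemma measure_ecdf_sub_ge_le [IsProbabilityMeasure P] {Z : ℕ → Ω → ℝ}
    (hZ : ∀ i, Measurable (Z i)) (hind : iIndepFun Z P)
    {N : ℕ} (hN : N ≠ 0) (x : ℝ) {ε : ℝ} (hε : 0 ≤ ε) :
    P.real {ω | ε ≤ |ecdf N (fun i => Z i ω) x - average N fun i => P.real {ω | Z i ω ≤ x}|} ≤
      2 * Real.exp (-2 * N * ε ^ 2) := by
  have hN' : (0 : ℝ) < N := by exact_mod_cast Nat.pos_of_ne_zero hN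
  set g : ℕ → ℝ → ℝ := fun i z => (if z ≤ x then 1 else 0) - P.real {ω | Z i ω ≤ x} with hg
  have hgm : ∀ i, Measurable (g i) := fun i =>
    (Measurable.ite measurableSet_Iic measurable_const measurable_const).sub_const _
  set Y : ℕ → Ω → ℝ := fun i ω => g i (Z i ω) with hY
  have hYind : iIndepFun Y P := hind.comp g hgm
  have hYneg : iIndepFun (fun i ω => -Y i ω) P :=
    hind.comp (fun i z => -g i z) fun i => (hgm i).neg
  have hsub : ∀ i, HasSubgaussianMGF (Y i) (1 / 4) P := by
    intro i
    have hm : Measurable fun ω => (if Z i ω ≤ x then 1 else 0 : ℝ) :=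
      (Measurable.ite measurableSet_Iic measurable_const measurable_const).comp (hZ i)
    have := hasSubgaussianMGF_of_mem_Icc (μ := P) (a := 0) (b := 1) hm.aemeasurable
      (Eventually.of_forall fun ω => by split_ifs <;> simp)
    rw [integral_ite_le_eq_measureReal (hZ i)] at this
    convert this using 1
    ext; norm_num
  have h1 := HasSubgaussianMGF.measure_sum_range_ge_le_of_iIndepFun hYind (n := N)
    (fun i _ => hsub i) (ε := N * ε) (by positivity)
  have h2 := HasSubgaussianMGF.measure_sum_range_ge_le_of_iIndepFun hYneg (n := N)
    (fun i _ => (hsub i).neg) (ε := N * ε) (by positivity)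
  have e : -(N * ε) ^ 2 / (2 * N * ((1 / 4 : ℝ≥0) : ℝ)) = -2 * N * ε ^ 2 := by
    push_cast; field_simp; ring
  rw [e] at h1 h2
  have hsum : ∀ ω, ecdf N (fun i => Z i ω) x - (average N fun i => P.real {ω | Z i ω ≤ x}) =
      (1 / N) * ∑ i ∈ Finset.range N, Y i ω := by
    intro ω; rw [ecdf, ← average_sub]; rfl
  calc _ ≤ P.real ({ω | N * ε ≤ ∑ i ∈ Finset.range N, Y i ω} ∪
        {ω | N * ε ≤ ∑ i ∈ Finset.range N, -Y i ω}) := by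
        refine measureReal_mono fun ω hω => ?_
        simp only [Set.mem_ofPred_eq, hsum] at hω
        rw [le_abs] at hω
        rcases hω with hω | hω
        · left
          simp only [Set.mem_ofPred_eq]
          calc N * ε ≤ N * (1 / N * ∑ i ∈ Finset.range N, Y i ω) := by gcongr
            _ = _ := by field_simp
        · right
          simp only [Set.mem_ofPred_eq, Finset.sum_neg_distrib]
          calc N * ε ≤ N * -(1 / N * ∑ i ∈ Finset.range N, Y i ω) := by gcongr
            _ = _ := by field_simp
    _ ≤ _ := (measureReal_union_le _ _).trans (by linarith)

/-- The event that the empirical distribution function deviates by more than `N ^ (-1/4)` from its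
mean at some point of the grid of step `1 / N` of `[-3, 3]`. -/
def gridDeviation (P : Measure Ω) (Z : ℕ → Ω → ℝ) (N : ℕ) : Set Ω :=
  {ω | ∃ k ∈ Finset.Icc (-(3 * N : ℤ)) (3 * N + 1), (N : ℝ) ^ (-(1 / 4) : ℝ) ≤
    |ecdf N (fun i => Z i ω) (k / N) - average N fun i => P.real {ω | Z i ω ≤ (k : ℝ) / N}|}

/-- The bound `exp (-2 √N) = O (N ^ (-d))` with an explicit constant. -/
lemma exp_neg_two_sqrt_le (d : ℕ) {N : ℕ} (hN : N ≠ 0) :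
    Real.exp (-2 * Real.sqrt N) ≤ (2 * d).factorial / (N : ℝ) ^ d := by
  have hN' : (0 : ℝ) < N := by exact_mod_cast Nat.pos_of_ne_zero hN
  have h1 := Real.pow_div_factorial_le_exp (2 * Real.sqrt N) (by positivity) (2 * d)
  have h2 : (N : ℝ) ^ d ≤ (2 * Real.sqrt N) ^ (2 * d) := by
    rw [pow_mul, mul_pow, Real.sq_sqrt hN'.le]
    exact pow_le_pow_left₀ hN'.le (by linarith) d
  rw [neg_mul, Real.exp_neg, le_div_iff₀ (by positivity), inv_mul_le_iff₀ (Real.exp_pos _)]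
  rw [div_le_iff₀ (by positivity)] at h1
  exact h2.trans h1

/-- Hoeffding's inequality with the deviation `N ^ (-1/4)` gives `exp (-2 √N)` at each of the
`O (N)` grid points, hence decay faster than every power of `N`. -/
lemma measure_gridDeviation_le [IsProbabilityMeasure P] {Z : ℕ → Ω → ℝ} (hZ : ∀ i, Measurable (Z i))
    (hind : iIndepFun Z P) (d : ℕ) {N : ℕ} (hN : N ≠ 0) :
    P.real (gridDeviation P Z N) ≤ 16 * (2 * (d + 1)).factorial / (N : ℝ) ^ d := by
  have hN' : (0 : ℝ) < N := by exact_mod_cast Nat.pos_of_ne_zero hN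
  have hN1 : (1 : ℝ) ≤ N := by exact_mod_cast Nat.one_le_iff_ne_zero.2 hN
  have hexp : -2 * (N : ℝ) * ((N : ℝ) ^ (-(1 / 4) : ℝ)) ^ 2 = -2 * Real.sqrt N := by
    rw [← Real.rpow_natCast, ← Real.rpow_mul hN'.le, Real.sqrt_eq_rpow, mul_assoc]
    congr 1
    nth_rewrite 1 [← Real.rpow_one (N : ℝ)]
    rw [← Real.rpow_add hN']; norm_num
  have hsub : gridDeviation P Z N ⊆ ⋃ k ∈ Finset.Icc (-(3 * N : ℤ)) (3 * N + 1),
      {ω | (N : ℝ) ^ (-(1 / 4) : ℝ) ≤ |ecdf N (fun i => Z i ω) ((k : ℝ) / N) -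
        average N fun i => P.real {ω | Z i ω ≤ (k : ℝ) / N}|} := by
    rintro ω ⟨k, hk, hω⟩
    exact Set.mem_iUnion₂.2 ⟨k, hk, hω⟩
  calc P.real (gridDeviation P Z N)
      ≤ ∑ k ∈ Finset.Icc (-(3 * N : ℤ)) (3 * N + 1), 2 * Real.exp (-2 * Real.sqrt N) := by
        refine (measureReal_mono hsub (measure_ne_top _ _)).trans
          ((measureReal_biUnion_finset_le _ _).trans ?_)
        refine Finset.sum_le_sum fun k _ => ?_
        rw [← hexp]
        exact measure_ecdf_sub_ge_le hZ hind hN _ (by positivity)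
    _ = (6 * N + 2) * (2 * Real.exp (-2 * Real.sqrt N)) := by
        rw [Finset.sum_const, Int.card_Icc, nsmul_eq_mul]
        congr 1
        have : (3 * (N : ℤ) + 1 + 1 - -(3 * N)).toNat = 6 * N + 2 := by omega
        rw [this]; push_cast; ring
    _ ≤ (8 * N) * (2 * ((2 * (d + 1)).factorial / (N : ℝ) ^ (d + 1))) := by
        gcongr
        · linarith
        · exact exp_neg_two_sqrt_le (d + 1) hN
    _ = _ := by rw [pow_succ]; field_simp; ring

/-- Outside the deviation event the empirical distribution function is uniformly close to any
Lipschitz function which it has as mean. -/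
lemma abs_ecdf_sub_le {Z : ℕ → Ω → ℝ} {G : ℝ → ℝ} {K : ℝ} {N : ℕ} (hN : N ≠ 0)
    (hG : ∀ x y, |G x - G y| ≤ K * |x - y|)
    (hmean : ∀ x, (average N fun i => P.real {ω | Z i ω ≤ x}) = G x) {ω : Ω}
    (hω : ω ∉ gridDeviation P Z N) {y : ℝ} (hy : |y| ≤ 3) :
    |ecdf N (fun i => Z i ω) y - G y| ≤ (N : ℝ) ^ (-(1 / 4) : ℝ) + K / N := by
  refine abs_sub_le_of_grid hN (ecdf_mono _ _) hG (fun k hk => ?_) hy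
  by_contra hcon
  push Not at hcon
  refine hω ⟨k, hk, ?_⟩
  rw [hmean]; exact hcon.le

end Probability

/-! ### The random effects and the perturbed random effects -/

section RandomEffects

variable {Ω : Type*} [MeasurableSpace Ω] {P : Measure Ω}

/-- Two independent sequences of independent variables form a sequence of independent pairs. -/
lemma iIndepFun_prodMk {ι α β : Type*} [MeasurableSpace α] [MeasurableSpace β]
    {φ : ι → Ω → α} {M : ι → Ω → β}
    (hφm : ∀ i, Measurable (φ i)) (hMm : ∀ i, Measurable (M i))
    (hφ : iIndepFun φ P) (hM : iIndepFun M P)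
    (h : IndepFun (fun ω i => φ i ω) (fun ω i => M i ω) P) :
    iIndepFun (fun i ω => (φ i ω, M i ω)) P := by
  have := hφ.isProbabilityMeasure
  -- preimages of rectangles generate the σ-algebra of each pair
  set π : ι → Set (Set Ω) := fun i =>
    Set.preimage (fun ω => (φ i ω, M i ω)) ''
      (Set.image2 (· ×ˢ ·) {s : Set α | MeasurableSet s} {t : Set β | MeasurableSet t}) with hπ
  have hpi : ∀ i (A : Set α) (B : Set β), MeasurableSet A → MeasurableSet B →
      P (φ i ⁻¹' A ∩ M i ⁻¹' B) = P (φ i ⁻¹' A) * P (M i ⁻¹' B) := by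
    intro i A B hA hB
    exact (h.comp (measurable_pi_apply i) (measurable_pi_apply i)).measure_inter_preimage_eq_mul
      A B hA hB
  refine iIndepSets.iIndep
    (m := fun i => MeasurableSpace.comap (fun ω => (φ i ω, M i ω)) inferInstance)
    (fun i => ((hφm i).prodMk (hMm i)).comap_le) π (fun i => ?_) (fun i => ?_) ?_
  · exact isPiSystem_prod.comap _
  · rw [hπ, ← generateFrom_prod, MeasurableSpace.comap_generateFrom]
  · rw [iIndepSets_iff]
    intro s f hf
    have hf' : ∀ i, ∃ A : Set α, ∃ B : Set β, MeasurableSet A ∧ MeasurableSet B ∧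
        (i ∈ s → f i = φ i ⁻¹' A ∩ M i ⁻¹' B) := by
      intro i
      by_cases hi : i ∈ s
      · obtain ⟨C, ⟨A, hA, B, hB, rfl⟩, hC⟩ := hf i hi
        exact ⟨A, B, hA, hB, fun _ => hC.symm⟩
      · exact ⟨∅, ∅, MeasurableSet.empty, MeasurableSet.empty, fun h => absurd h hi⟩
    choose A B hA hB hfAB using hf'
    have e1 : (⋂ i ∈ s, f i) = (⋂ i ∈ s, φ i ⁻¹' A i) ∩ (⋂ i ∈ s, M i ⁻¹' B i) := by
      ext ω
      simp only [Set.mem_iInter, Set.mem_inter_iff]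
      constructor
      · intro hω
        exact ⟨fun i hi => ((hfAB i hi) ▸ hω i hi).1, fun i hi => ((hfAB i hi) ▸ hω i hi).2⟩
      · rintro ⟨ha, hb⟩ i hi
        rw [hfAB i hi]; exact ⟨ha i hi, hb i hi⟩
    have e2 : P ((⋂ i ∈ s, φ i ⁻¹' A i) ∩ (⋂ i ∈ s, M i ⁻¹' B i)) =
        P (⋂ i ∈ s, φ i ⁻¹' A i) * P (⋂ i ∈ s, M i ⁻¹' B i) := by
      have := h.measure_inter_preimage_eq_mul (⋂ i ∈ s, (fun x : ι → α => x i) ⁻¹' A i)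
        (⋂ i ∈ s, (fun x : ι → β => x i) ⁻¹' B i)
        (Finset.measurableSet_biInter s fun i _ => measurable_pi_apply i (hA i))
        (Finset.measurableSet_biInter s fun i _ => measurable_pi_apply i (hB i))
      simpa only [Set.preimage_iInter, ← Set.preimage_comp, Function.comp_def] using this
    rw [e1, e2, hφ.measure_inter_preimage_eq_mul s fun i _ => hA i,
      hM.measure_inter_preimage_eq_mul s fun i _ => hB i, ← Finset.prod_mul_distrib]
    refine Finset.prod_congr rfl fun i hi => ?_
    rw [hfAB i hi, hpi i _ _ (hA i) (hB i)]

/-- The distribution function of a sum of independent variables. -/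
lemma measureReal_add_le_eq_integral [IsProbabilityMeasure P] {φ T : Ω → ℝ} (hφ : Measurable φ)
    (hT : Measurable T) (h : IndepFun φ T P) (y : ℝ) :
    P.real {ω | φ ω + T ω ≤ y} = ∫ ω, cdf (P.map φ) (y - T ω) ∂P := by
  have := Measure.isProbabilityMeasure_map (μ := P) hφ.aemeasurable
  have := Measure.isProbabilityMeasure_map (μ := P) hT.aemeasurable
  have hs : MeasurableSet {p : ℝ × ℝ | p.1 + p.2 ≤ y} :=
    measurableSet_le (measurable_fst.add measurable_snd) measurable_const
  have h1 : P {ω | φ ω + T ω ≤ y} = ∫⁻ t, P.map φ (Set.Iic (y - t)) ∂(P.map T) := by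
    have e : {ω | φ ω + T ω ≤ y} = (fun ω => (φ ω, T ω)) ⁻¹' {p : ℝ × ℝ | p.1 + p.2 ≤ y} := rfl
    rw [e, ← Measure.map_apply (hφ.prodMk hT) hs,
      (indepFun_iff_map_prod_eq_prod_map_map hφ.aemeasurable hT.aemeasurable).1 h,
      Measure.prod_apply_symm hs]
    congr 1; ext t; congr 1; ext x
    simp [le_sub_iff_add_le]
  have hmeas : Measurable fun t => cdf (P.map φ) (y - t) :=
    (monotone_cdf (P.map φ)).measurable.comp (measurable_const.sub measurable_id)
  rw [← integral_map (f := fun t => cdf (P.map φ) (y - t)) hT.aemeasurable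
    hmeas.aestronglyMeasurable, Measure.real, h1]
  rw [integral_eq_lintegral_of_nonneg_ae (Eventually.of_forall fun t => cdf_nonneg _ _)
    hmeas.aestronglyMeasurable]
  congr 2; ext t
  rw [cdf_eq_real, ofReal_measureReal]

/-- A bounded density on the support makes the distribution function Lipschitz. -/
lemma cdf_lipschitz {μ : Measure ℝ} [IsProbabilityMeasure μ] {f : ℝ → ℝ} {C : ℝ}
    (hf : μ = volume.withDensity fun x => ENNReal.ofReal (f x))
    (hsupp : ∀ᵐ x ∂μ, x ∈ Set.Icc (-1 : ℝ) 1) (hC : ∀ x ∈ Set.Icc (-1 : ℝ) 1, |f x| ≤ C)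
    (x y : ℝ) : |cdf μ x - cdf μ y| ≤ C * |x - y| := by
  have hC0 : 0 ≤ C := (abs_nonneg _).trans (hC 0 (by constructor <;> norm_num))
  have key : ∀ x y : ℝ, x ≤ y → cdf μ y - cdf μ x ≤ C * (y - x) := by
    intro x y hxy
    have h1 : μ (Set.Ioc x y) = ENNReal.ofReal (cdf μ y - cdf μ x) := by
      conv_lhs => rw [← measure_cdf μ]
      rw [StieltjesFunction.measure_Ioc]
    have h2 : μ (Set.Ioc x y) ≤ ENNReal.ofReal (C * (y - x)) := by
      have e : μ (Set.Ioc x y) = μ (Set.Ioc x y ∩ Set.Icc (-1) 1) := by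
        refine measure_congr ?_
        filter_upwards [hsupp] with z hz
        exact propext ⟨fun h => ⟨h, hz⟩, fun h => h.1⟩
      have hm : MeasurableSet (Set.Ioc x y ∩ Set.Icc (-1 : ℝ) 1) :=
        measurableSet_Ioc.inter measurableSet_Icc
      rw [e, hf, withDensity_apply _ hm]
      calc _ ≤ ∫⁻ _ in Set.Ioc x y ∩ Set.Icc (-1 : ℝ) 1, ENNReal.ofReal C := by
            refine setLIntegral_mono measurable_const fun z hz => ?_
            exact ENNReal.ofReal_le_ofReal ((le_abs_self _).trans (hC z hz.2))
        _ ≤ ENNReal.ofReal C * volume (Set.Ioc x y) := by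
            rw [setLIntegral_const]
            gcongr; exact Set.inter_subset_left
        _ = _ := by rw [Real.volume_Ioc, ← ENNReal.ofReal_mul hC0]
    rw [h1] at h2
    exact (ENNReal.ofReal_le_ofReal_iff (mul_nonneg hC0 (by linarith))).1 h2
  rcases le_total x y with h | h
  · rw [abs_of_nonpos (sub_nonpos.2 (monotone_cdf μ h)), abs_of_nonpos (sub_nonpos.2 h)]
    linarith [key x y h]
  · rw [abs_of_nonneg (sub_nonneg.2 (monotone_cdf μ h)), abs_of_nonneg (sub_nonneg.2 h)]
    exact key y x h

lemma integrable_cdf_sub [IsProbabilityMeasure P] {μ : Measure ℝ} [IsProbabilityMeasure μ]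
    {T : Ω → ℝ} (hT : Measurable T) (y : ℝ) : Integrable (fun ω => cdf μ (y - T ω)) P := by
  refine Integrable.of_mem_Icc 0 1 ?_
    (Eventually.of_forall fun ω => ⟨cdf_nonneg _ _, cdf_le_one _ _⟩)
  exact ((monotone_cdf μ).measurable.comp (measurable_const.sub hT)).aemeasurable

lemma integral_cdf_sub_lipschitz [IsProbabilityMeasure P] {μ : Measure ℝ} [IsProbabilityMeasure μ]
    {T : Ω → ℝ} (hT : Measurable T) {K : ℝ} (hK : ∀ x y, |cdf μ x - cdf μ y| ≤ K * |x - y|)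
    (x y : ℝ) : |∫ ω, cdf μ (x - T ω) ∂P - ∫ ω, cdf μ (y - T ω) ∂P| ≤ K * |x - y| := by
  rw [← integral_sub (integrable_cdf_sub hT x) (integrable_cdf_sub hT y), ← Real.norm_eq_abs]
  refine (norm_integral_le_of_norm_le_const (C := K * |x - y|)
    (Eventually.of_forall fun ω => ?_)).trans (by simp)
  refine (hK _ _).trans (le_of_eq ?_)
  congr 2; ring

/-- Adding a perturbation with a small first moment changes a Lipschitz distribution function
little. -/
lemma abs_integral_cdf_sub_le [IsProbabilityMeasure P] {μ : Measure ℝ} [IsProbabilityMeasure μ]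
    {T : Ω → ℝ} (hT : Measurable T) (hTi : Integrable T P) {K : ℝ}
    (hK : ∀ x y, |cdf μ x - cdf μ y| ≤ K * |x - y|) (y : ℝ) :
    |∫ ω, cdf μ (y - T ω) ∂P - cdf μ y| ≤ K * ∫ ω, |T ω| ∂P := by
  have e : ∫ ω, cdf μ (y - T ω) ∂P - cdf μ y = ∫ ω, (cdf μ (y - T ω) - cdf μ y) ∂P := by
    rw [integral_sub (integrable_cdf_sub hT y) (integrable_const _)]; simp
  rw [← integral_const_mul, e]
  refine (abs_integral_le_integral_abs).trans (integral_mono ?_ (hTi.abs.const_mul K) fun ω => ?_)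
  · exact ((integrable_cdf_sub hT y).sub (integrable_const _)).abs
  · refine (hK _ _).trans (le_of_eq ?_)
    rw [sub_sub_cancel_left, abs_neg]

end RandomEffects

/-! ### Empirical distribution of the perturbed random effects -/

section PerturbedEffects

variable {Ω : Type*} [MeasurableSpace Ω] {P : Measure Ω}

/-- The Borel–Cantelli lemma over a countable index. -/
lemma ae_eventually_notMem_cofinite [IsFiniteMeasure P] {ι : Type*} [Countable ι] {E : ι → Set Ω}
    {c : ι → ℝ} (hE : ∀ i, P.real (E i) ≤ c i) (hc : Summable c) :
    ∀ᵐ ω ∂P, ∀ᶠ i in cofinite, ω ∉ E i := by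
  have h : ∑' i, P (E i) ≠ ∞ := by
    refine ne_top_of_le_ne_top hc.tsum_ofReal_ne_top (ENNReal.tsum_le_tsum fun i => ?_)
    rw [← ofReal_measureReal]
    exact ENNReal.ofReal_le_ofReal (hE i)
  filter_upwards [ae_finite_setOfPred_mem h] with ω hω
  simpa [eventually_cofinite] using hω

/-- Markov's inequality for an even moment, over finitely many variables. -/
lemma measureReal_exists_abs_gt_le [IsProbabilityMeasure P] {T : ℕ → Ω → ℝ} {p N : ℕ} {b δ : ℝ}
    (hδ : 0 < δ) (hT : ∀ i, Integrable (fun ω => T i ω ^ (2 * p)) P)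
    (hb : ∀ i, ∫ ω, T i ω ^ (2 * p) ∂P ≤ b) :
    P.real {ω | ∃ i < N, δ < |T i ω|} ≤ N * (b / δ ^ (2 * p)) := by
  have h1 : ∀ i, P.real {ω | δ < |T i ω|} ≤ b / δ ^ (2 * p) := by
    intro i
    rw [le_div_iff₀ (by positivity), mul_comm]
    have hpos : ∀ x : ℝ, 0 ≤ x ^ (2 * p) := fun x => by rw [pow_mul]; positivity
    refine le_trans ?_ ((mul_meas_ge_le_integral_of_nonneg
      (Eventually.of_forall fun ω => hpos _) (hT i) (δ ^ (2 * p))).trans (hb i))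
    refine mul_le_mul_of_nonneg_left (measureReal_mono fun ω hω => ?_) (hpos δ)
    simp only [Set.mem_ofPred_eq] at hω ⊢
    rw [← (even_two_mul p).pow_abs (T i ω)]
    exact pow_le_pow_left₀ hδ.le hω.le _
  have hsub : {ω | ∃ i < N, δ < |T i ω|} ⊆ ⋃ i ∈ Finset.range N, {ω | δ < |T i ω|} := by
    rintro ω ⟨i, hi, hω⟩
    exact Set.mem_iUnion₂.2 ⟨i, Finset.mem_range.2 hi, hω⟩
  calc _ ≤ ∑ i ∈ Finset.range N, b / δ ^ (2 * p) :=
        (measureReal_mono hsub (measure_ne_top _ _)).trans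
          ((measureReal_biUnion_finset_le _ _).trans (Finset.sum_le_sum fun i _ => h1 i))
    _ = _ := by simp

/-- If an empirical distribution function is close to a Lipschitz function, a small perturbation of
the data changes it little. -/
lemma abs_ecdf_add_sub_le {N : ℕ} {z t : ℕ → ℝ} {G : ℝ → ℝ} {K δ ε y : ℝ}
    (hG : ∀ x y, |G x - G y| ≤ K * |x - y|) (ht : ∀ i < N, |t i| ≤ δ) (hδ : 0 ≤ δ)
    (h₁ : |ecdf N z (y - δ) - G (y - δ)| ≤ ε) (h₂ : |ecdf N z (y + δ) - G (y + δ)| ≤ ε) :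
    |ecdf N (fun i => z i + t i) y - G y| ≤ ε + K * δ := by
  have u1 : ecdf N z (y - δ) ≤ ecdf N (fun i => z i + t i) y := by
    refine average_mono fun i hi => ?_
    have := abs_le.1 (ht i hi)
    split_ifs with a b
    · exact le_rfl
    · exact absurd (by linarith [this.2]) b
    · exact zero_le_one
    · exact le_rfl
  have u2 : ecdf N (fun i => z i + t i) y ≤ ecdf N z (y + δ) := by
    refine average_mono fun i hi => ?_
    have := abs_le.1 (ht i hi)
    split_ifs with a b
    · exact le_rfl
    · exact absurd (by linarith [this.1]) b
    · exact zero_le_one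
    · exact le_rfl
  have g1 := hG (y - δ) y
  have g2 := hG (y + δ) y
  rw [sub_sub_cancel_left, abs_neg, abs_of_nonneg hδ] at g1
  rw [add_sub_cancel_left, abs_of_nonneg hδ] at g2
  rw [abs_le] at *
  constructor <;> linarith [h₁.1, h₂.2, g1.1, g2.2]

/-- The empirical distribution functions of independent variables `φ i + T i n`, `i < N`, where
the `φ i` have a Lipschitz distribution function and the moments of the perturbations `T i n`
decay polynomially in `n`, converge to the distribution function of `φ i`, at the rate
`N ^ (-1/4)` up to a deterministic Lipschitz term which vanishes in the joint limit. -/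
theorem exists_lipschitz_approx_ecdf [IsProbabilityMeasure P] {φ : ℕ → Ω → ℝ}
    {T : ℕ → ℕ → Ω → ℝ} {μ : Measure ℝ} [IsProbabilityMeasure μ] {K β : ℝ} {C : ℕ → ℝ}
    (hφ : ∀ i, Measurable (φ i)) (hT : ∀ i n, Measurable (T i n)) (hφind : iIndepFun φ P)
    (hZind : ∀ n, iIndepFun (fun i ω => φ i ω + T i n ω) P)
    (hφT : ∀ i n, IndepFun (φ i) (T i n) P) (hμ : ∀ i, P.map (φ i) = μ)
    (hK : ∀ x y, |cdf μ x - cdf μ y| ≤ K * |x - y|) (hβ : 0 < β) (hC : ∀ p, 0 ≤ C p)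
    (hTint : ∀ i n p, Integrable (fun ω => T i n ω ^ p) P)
    (hTmom : ∀ i n p, ∫ ω, T i n ω ^ (2 * p) ∂P ≤ C p * (n : ℝ) ^ (-(p * β))) :
    ∃ G : ℕ × ℕ → ℝ → ℝ, (∀ q x y, |G q x - G q y| ≤ K * |x - y|) ∧
      (∀ ε > 0, ∀ᶠ q in (atTop ×ˢ atTop : Filter (ℕ × ℕ)), ∀ y, |G q y - cdf μ y| ≤ ε) ∧
      ∀ᵐ ω ∂P, ∀ᶠ q : ℕ × ℕ in atTop ×ˢ atTop, ∀ y, |y| ≤ 2 →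
        |ecdf q.2 (fun i => φ i ω + T i q.1 ω) y - G q y| ≤
          (1 + 2 * K) * (q.2 : ℝ) ^ (-(1 / 4) : ℝ) := by
  have hK0 : 0 ≤ K := by simpa using (abs_nonneg _).trans (hK 1 0)
  -- a moment of order `2 p` of the perturbations is `O (n ^ (-4))`
  obtain ⟨p, hp⟩ := exists_nat_gt (4 / β)
  rw [div_lt_iff₀ hβ] at hp
  set κ := p + 3 with hκ
  set D : ℕ → ℕ → ℝ → ℝ := fun n N y => average N fun i => P.real {ω | φ i ω + T i n ω ≤ y}
    with hD
  have hDi : ∀ i n y, P.real {ω | φ i ω + T i n ω ≤ y} = ∫ ω, cdf μ (y - T i n ω) ∂P :=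
    fun i n y => by rw [← hμ i]; exact measureReal_add_le_eq_integral (hφ i) (hT i n) (hφT i n) y
  have habs_avg : ∀ (N : ℕ) (u : ℕ → ℝ) (c : ℝ), 0 ≤ c → (∀ i < N, |u i| ≤ c) →
      |average N u| ≤ c := by
    intro N u c hc hu
    rcases Nat.eq_zero_or_pos N with rfl | hN
    · simpa [average] using hc
    have hN' : (0 : ℝ) < N := by exact_mod_cast hN
    rw [average, abs_mul, abs_of_pos (by positivity), one_div, inv_mul_le_iff₀ hN']
    refine (Finset.abs_sum_le_sum_abs _ _).trans ?_
    calc _ ≤ ∑ i ∈ Finset.range N, c :=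
          Finset.sum_le_sum fun i hi => hu i (Finset.mem_range.1 hi)
      _ = _ := by simp
  have hDlip : ∀ n N x y, |D n N x - D n N y| ≤ K * |x - y| := by
    intro n N x y
    simp only [hD, ← average_sub]
    refine habs_avg N _ _ (by positivity) fun i _ => ?_
    rw [hDi, hDi]
    exact integral_cdf_sub_lipschitz (hT i n) hK x y
  -- for few observations `G` is the exact mean, for many observations it is the limit
  refine ⟨fun q y => if q.1 < q.2 ^ κ then D q.1 q.2 y else cdf μ y, fun q x y => ?_,
    fun ε hε => ?_, ?_⟩
  · dsimp only
    split_ifs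
    · exact hDlip _ _ _ _
    · exact hK _ _
  · set ε' := ε / (2 * (K + 1)) with hε'
    have hε'0 : 0 < ε' := by positivity
    have hlim : Tendsto (fun n : ℕ => C 1 * (n : ℝ) ^ (-((1 : ℕ) * β))) atTop (𝓝 0) := by
      have := ((tendsto_rpow_neg_atTop hβ).comp tendsto_natCast_atTop_atTop).const_mul (C 1)
      simpa [Function.comp_def] using this
    have hev : ∀ᶠ n : ℕ in atTop, C 1 * (n : ℝ) ^ (-((1 : ℕ) * β)) < ε' ^ 2 :=
      hlim.eventually_lt_const (by positivity)
    filter_upwards [tendsto_fst.eventually hev] with q hq y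
    have hL1 : ∀ i, ∫ ω, |T i q.1 ω| ∂P ≤ 2 * ε' := by
      intro i
      have hi2 : Integrable (fun ω => ε' + T i q.1 ω ^ 2 / ε') P :=
        (integrable_const _).add ((hTint i q.1 2).div_const _)
      have h1 : ∫ ω, |T i q.1 ω| ∂P ≤ ∫ ω, (ε' + T i q.1 ω ^ 2 / ε') ∂P := by
        refine integral_mono (by simpa using (hTint i q.1 1).abs) hi2 fun ω => ?_
        dsimp only
        rw [← sub_le_iff_le_add', le_div_iff₀ hε'0, ← sq_abs]
        nlinarith [sq_nonneg (|T i q.1 ω| - ε'), abs_nonneg (T i q.1 ω)]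
      have e : ∫ ω, (ε' + T i q.1 ω ^ 2 / ε') ∂P = ε' + (∫ ω, T i q.1 ω ^ 2 ∂P) / ε' := by
        rw [integral_add (integrable_const _) ((hTint i q.1 2).div_const _), integral_const,
          integral_div]
        simp
      have h2 := (hTmom i q.1 1).trans hq.le
      have h3 : (∫ ω, T i q.1 ω ^ 2 ∂P) / ε' ≤ ε' := by
        rw [div_le_iff₀ hε'0, ← sq]; simpa using h2
      linarith
    have hbound : K * (2 * ε') ≤ ε := by
      rw [hε', ← mul_assoc, mul_div_assoc', div_le_iff₀ (by positivity)]; nlinarith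
    split_ifs with hlt
    · have hN : q.2 ≠ 0 := by
        intro h0; rw [h0, zero_pow (by omega)] at hlt; omega
      have e : cdf μ y = average q.2 fun _ => cdf μ y := (average_const hN _).symm
      rw [e, hD, ← average_sub]
      refine habs_avg _ _ _ hε.le fun i _ => ?_
      rw [hDi]
      refine (abs_integral_cdf_sub_le (hT i q.1) (by simpa using hTint i q.1 1) hK y).trans ?_
      exact (mul_le_mul_of_nonneg_left (hL1 i) hK0).trans hbound
    · simpa using hε.le
  · -- bad events: deviations for few observations; deviations of the unperturbed effects;
    -- a large perturbation for many observations
    set E₁ : ℕ × ℕ → Set Ω := fun q => if q.1 ≠ 0 ∧ q.1 < q.2 ^ κ then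
      gridDeviation P (fun i ω => φ i ω + T i q.1 ω) q.2 else ∅ with hE₁
    set E₂ : ℕ → Set Ω := fun N => if N ≠ 0 then gridDeviation P φ N else ∅ with hE₂
    set E₃ : ℕ × ℕ → Set Ω := fun q => if q.1 ≠ 0 ∧ q.2 ≠ 0 ∧ q.2 ^ κ ≤ q.1 then
      {ω | ∃ i < q.2, (q.2 : ℝ) ^ (-(1 / 4) : ℝ) < |T i q.1 ω|} else ∅ with hE₃
    have hsum : ∀ c : ℝ, Summable fun q : ℕ × ℕ => c * (1 / (q.1 : ℝ) ^ 2 * (1 / (q.2 : ℝ) ^ 2)) :=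
      fun c => ((Real.summable_one_div_nat_pow.2 one_lt_two).mul_of_nonneg
        (Real.summable_one_div_nat_pow.2 one_lt_two) (fun _ => by positivity)
        fun _ => by positivity).mul_left c
    have hP₁ : ∀ q, P.real (E₁ q) ≤ (16 * (2 * (2 * κ + 2 + 1)).factorial : ℝ) *
        (1 / (q.1 : ℝ) ^ 2 * (1 / (q.2 : ℝ) ^ 2)) := by
      intro q
      simp only [hE₁]
      split_ifs with hq
      · have hN : q.2 ≠ 0 := by
          intro h0; have := hq.2; rw [h0, zero_pow (by omega)] at this; omega
        refine (measure_gridDeviation_le (fun i => (hφ i).add (hT i q.1)) (hZind q.1)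
          (2 * κ + 2) hN).trans ?_
        have h1 : (0 : ℝ) < q.1 := by exact_mod_cast Nat.pos_of_ne_zero hq.1
        have h2 : (0 : ℝ) < q.2 := by exact_mod_cast Nat.pos_of_ne_zero hN
        have h3 : (q.1 : ℝ) ≤ (q.2 : ℝ) ^ κ := by exact_mod_cast hq.2.le
        rw [div_eq_mul_one_div, one_div_mul_one_div, pow_add, mul_comm 2 κ, pow_mul]
        gcongr
      · rw [measureReal_empty]; positivity
    have hP₂ : ∀ N, P.real (E₂ N) ≤ (16 * (2 * (2 + 1)).factorial : ℝ) * (1 / (N : ℝ) ^ 2) := by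
      intro N
      simp only [hE₂]
      split_ifs with hN
      · refine (measure_gridDeviation_le hφ hφind 2 hN).trans (le_of_eq ?_)
        rw [div_eq_mul_one_div]
      · rw [measureReal_empty]; positivity
    have hP₃ : ∀ q, P.real (E₃ q) ≤ C p * (1 / (q.1 : ℝ) ^ 2 * (1 / (q.2 : ℝ) ^ 2)) := by
      intro q
      simp only [hE₃]
      split_ifs with hq
      · obtain ⟨h1, h2, h3⟩ := hq
        have h1' : (1 : ℝ) ≤ q.1 := by exact_mod_cast Nat.one_le_iff_ne_zero.2 h1
        have h2' : (1 : ℝ) ≤ q.2 := by exact_mod_cast Nat.one_le_iff_ne_zero.2 h2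
        have h20 : (0 : ℝ) < q.2 := by linarith
        have h10 : (0 : ℝ) < q.1 := by linarith
        have h3' : (q.2 : ℝ) ^ κ ≤ q.1 := by exact_mod_cast h3
        refine (measureReal_exists_abs_gt_le (by positivity) (fun i => hTint i q.1 (2 * p))
          fun i => hTmom i q.1 p).trans ?_
        have a1 : (q.1 : ℝ) ^ (-(p * β)) ≤ 1 / ((q.1 : ℝ) ^ 2 * (q.2 : ℝ) ^ (2 * κ)) := by
          calc (q.1 : ℝ) ^ (-(p * β)) ≤ (q.1 : ℝ) ^ (-(4 : ℕ) : ℝ) :=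
                Real.rpow_le_rpow_of_exponent_le h1' (by push_cast; linarith)
            _ = 1 / ((q.1 : ℝ) ^ 2 * (q.1 : ℝ) ^ 2) := by
                rw [Real.rpow_neg h10.le, Real.rpow_natCast, one_div]; ring
            _ ≤ _ := by
                rw [mul_comm 2 κ, pow_mul]
                gcongr
        have a2 : 1 / ((q.2 : ℝ) ^ (-(1 / 4) : ℝ)) ^ (2 * p) ≤ (q.2 : ℝ) ^ p := by
          rw [← Real.rpow_natCast, ← Real.rpow_mul h20.le, one_div, ← Real.rpow_neg h20.le,
            ← Real.rpow_natCast]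
          refine Real.rpow_le_rpow_of_exponent_le h2' ?_
          push_cast
          linarith [(Nat.cast_nonneg p : (0 : ℝ) ≤ p)]
        rw [div_eq_mul_one_div]
        calc _ ≤ (q.2 : ℝ) * (C p * (1 / ((q.1 : ℝ) ^ 2 * (q.2 : ℝ) ^ (2 * κ))) *
              (q.2 : ℝ) ^ p) := by
              have := hC p
              gcongr
          _ = C p * (1 / (q.1 : ℝ) ^ 2) * ((q.2 : ℝ) ^ (p + 1) / (q.2 : ℝ) ^ (2 * κ)) := by
              field_simp; ring
          _ ≤ C p * (1 / (q.1 : ℝ) ^ 2) * (1 / (q.2 : ℝ) ^ 2) := by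
              have := hC p
              refine mul_le_mul_of_nonneg_left ?_ (by positivity)
              rw [div_le_div_iff₀ (by positivity) (by positivity), ← pow_add, one_mul]
              exact pow_le_pow_right₀ h2' (by omega)
          _ = _ := by ring
      · rw [measureReal_empty]; have := hC p; positivity
    filter_upwards [ae_eventually_notMem_cofinite hP₁ (hsum _),
      ae_eventually_notMem_cofinite hP₂
        ((Real.summable_one_div_nat_pow.2 one_lt_two).mul_left _),
      ae_eventually_notMem_cofinite hP₃ (hsum _)] with ω h1 h2 h3
    rw [Nat.cofinite_eq_atTop] at h2
    filter_upwards [atTop_prod_atTop_le_cofinite h1, atTop_prod_atTop_le_cofinite h3,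
      tendsto_snd.eventually h2, tendsto_fst.eventually_ne_atTop 0,
      tendsto_snd.eventually_ne_atTop 0] with q q1 q3 q2 hn hN y hy
    have hN1 : (1 : ℝ) ≤ q.2 := by exact_mod_cast Nat.one_le_iff_ne_zero.2 hN
    have hN0 : (0 : ℝ) < q.2 := by linarith
    set δ := (q.2 : ℝ) ^ (-(1 / 4) : ℝ) with hδ
    have hδ0 : 0 ≤ δ := by positivity
    have hδ1 : δ ≤ 1 := Real.rpow_le_one_of_one_le_of_nonpos hN1 (by norm_num)
    have hKδ : K / q.2 ≤ K * δ := by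
      rw [div_eq_mul_inv, ← Real.rpow_neg_one]
      exact mul_le_mul_of_nonneg_left
        (Real.rpow_le_rpow_of_exponent_le hN1 (by norm_num)) hK0
    by_cases hlt : q.1 < q.2 ^ κ
    · have q1' : ω ∉ gridDeviation P (fun i ω => φ i ω + T i q.1 ω) q.2 := by
        simpa [hE₁, hn, hlt] using q1
      rw [if_pos hlt]
      have := abs_ecdf_sub_le hN (hDlip q.1 q.2) (fun x => rfl) q1' (hy.trans (by norm_num))
      refine this.trans ?_
      nlinarith [mul_nonneg hK0 hδ0]
    · have q2' : ω ∉ gridDeviation P φ q.2 := by simpa [hE₂, hN] using q2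
      have q3' : ∀ i < q.2, |T i q.1 ω| ≤ δ := by
        intro i hi
        by_contra hcon
        refine q3 ?_
        simp only [hE₃]
        rw [if_pos ⟨hn, hN, not_lt.1 hlt⟩]
        exact ⟨i, hi, not_le.1 hcon⟩
      rw [if_neg hlt]
      have hmean : ∀ x, (average q.2 fun i => P.real {ω | φ i ω ≤ x}) = cdf μ x := by
        intro x
        have : ∀ i, P.real {ω | φ i ω ≤ x} = cdf μ x := by
          intro i
          rw [cdf_eq_real, ← hμ i, map_measureReal_apply (hφ i) measurableSet_Iic]; rfl
        simp only [this]
        exact average_const hN _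
      rw [abs_le] at hy
      have := abs_ecdf_add_sub_le hK q3' hδ0
        (abs_ecdf_sub_le hN hK hmean q2' (y := y - δ) (abs_le.2 ⟨by linarith, by linarith⟩))
        (abs_ecdf_sub_le hN hK hmean q2' (y := y + δ) (abs_le.2 ⟨by linarith, by linarith⟩))
      refine this.trans ?_
      linarith

end PerturbedEffects

/-! ### Uniform convergence of the interpolated empirical distribution function -/

lemma tendsto_one_add_log_mul_inv_sqrt :
    Tendsto (fun M : ℕ => (1 + Real.log (M + 2)) / Real.sqrt M) atTop (𝓝 0) := by
  have h0 : Tendsto (fun M : ℕ => (1 : ℝ) / Real.sqrt M) atTop (𝓝 0) :=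
    (tendsto_const_nhds (x := (1 : ℝ))).div_atTop
      (Real.tendsto_sqrt_atTop.comp tendsto_natCast_atTop_atTop)
  have h1 : Tendsto (fun M : ℕ => Real.log M / Real.sqrt M) atTop (𝓝 0) := by
    have := (isLittleO_log_rpow_atTop (r := 1 / 2) (by norm_num)).tendsto_div_nhds_zero.comp
      (tendsto_natCast_atTop_atTop (R := ℝ))
    refine this.congr fun M => ?_
    simp [Real.sqrt_eq_rpow]
  have h2 : Tendsto (fun M : ℕ => (1 + Real.log 3) * (1 / Real.sqrt M) + Real.log M / Real.sqrt M)
      atTop (𝓝 0) := by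
    simpa using (h0.const_mul (1 + Real.log 3)).add h1
  refine squeeze_zero' (Eventually.of_forall fun M => ?_) ?_ h2
  · have : 0 ≤ Real.log ((M : ℝ) + 2) := Real.log_nonneg (by linarith [Nat.cast_nonneg (α := ℝ) M])
    positivity
  · filter_upwards [eventually_ge_atTop 1] with M hM
    have hM' : (1 : ℝ) ≤ M := by exact_mod_cast hM
    have : Real.log ((M : ℝ) + 2) ≤ Real.log 3 + Real.log M := by
      rw [← Real.log_mul (by norm_num) (by positivity)]
      exact Real.log_le_log (by positivity) (by linarith)
    rw [mul_one_div, ← add_div]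
    exact div_le_div_of_nonneg_right (by linarith) (Real.sqrt_nonneg _)

/-- The Lebesgue constants, of the order of `log (m N)`, are negligible with respect to the rate
`N ^ (-1/4)` of convergence at the nodes. -/
lemma tendsto_log_mul_rpow_neg {m : ℕ → ℕ}
    (hmo : (fun N : ℕ => (m N : ℝ)) =o[atTop] fun N : ℕ => Real.sqrt N / Real.log N) :
    Tendsto (fun N : ℕ => (1 + Real.log ((m N : ℝ) + 1)) * (N : ℝ) ^ (-(1 / 4) : ℝ))
      atTop (𝓝 0) := by
  have h0 : Tendsto (fun N : ℕ => (N : ℝ) ^ (-(1 / 4) : ℝ)) atTop (𝓝 0) :=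
    (tendsto_rpow_neg_atTop (by norm_num)).comp tendsto_natCast_atTop_atTop
  have h1 : Tendsto (fun N : ℕ => Real.log N * (N : ℝ) ^ (-(1 / 4) : ℝ)) atTop (𝓝 0) := by
    have := (isLittleO_log_rpow_atTop (r := 1 / 4) (by norm_num)).tendsto_div_nhds_zero.comp
      (tendsto_natCast_atTop_atTop (R := ℝ))
    refine this.congr fun N => ?_
    simp only [Function.comp]
    rw [Real.rpow_neg (Nat.cast_nonneg N), div_eq_mul_inv]
  have h2 := h0.add h1
  rw [add_zero] at h2
  refine squeeze_zero' (Eventually.of_forall fun N => ?_) ?_ h2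
  · have : 0 ≤ Real.log ((m N : ℝ) + 1) :=
      Real.log_nonneg (by linarith [Nat.cast_nonneg (α := ℝ) (m N)])
    positivity
  · have hlog : ∀ᶠ N : ℕ in atTop, 1 ≤ Real.log N :=
      (Real.tendsto_log_atTop.comp tendsto_natCast_atTop_atTop).eventually_ge_atTop 1
    filter_upwards [hmo.bound one_pos, hlog, eventually_ge_atTop 4] with N hN hl h4
    have h4' : (4 : ℝ) ≤ N := by exact_mod_cast h4
    have hs : Real.sqrt N ≤ N / 2 := by
      rw [Real.sqrt_le_left (by positivity)]; nlinarith
    have hmN : (m N : ℝ) + 1 ≤ N := by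
      have : (m N : ℝ) ≤ Real.sqrt N := by
        rw [one_mul, Real.norm_eq_abs, Real.norm_eq_abs, abs_of_nonneg (Nat.cast_nonneg _),
          abs_of_nonneg (by positivity)] at hN
        exact hN.trans (div_le_self (Real.sqrt_nonneg _) hl)
      linarith
    rw [← one_add_mul]
    gcongr

/-- Interpolation at the Chebyshev nodes of functions which are close, at the rate `N ^ (-1/4)`,
to equi-Lipschitz functions converging uniformly. -/
lemma tendstoUniformlyOn_interpolation {m : ℕ → ℕ} (hm : Tendsto m atTop atTop)
    (hmo : (fun N : ℕ => (m N : ℝ)) =o[atTop] fun N : ℕ => Real.sqrt N / Real.log N)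
    {A G : ℕ × ℕ → ℝ → ℝ} {F : ℝ → ℝ} {δ : ℕ × ℕ → ℝ} {K C : ℝ}
    (hG : ∀ q x y, |G q x - G q y| ≤ K * |x - y|)
    (hGF : ∀ ε > 0, ∀ᶠ q in (atTop ×ˢ atTop : Filter (ℕ × ℕ)), ∀ y, |G q y - F y| ≤ ε)
    (hδ : Tendsto δ (atTop ×ˢ atTop) (𝓝 0))
    (hA : ∀ᶠ q : ℕ × ℕ in atTop ×ˢ atTop, ∀ y ∈ Set.Icc (-1 : ℝ) 1,
      |A q y - G q (y - δ q)| ≤ C * (q.2 : ℝ) ^ (-(1 / 4) : ℝ)) :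
    TendstoUniformlyOn (fun (q : ℕ × ℕ) (x : ℝ) => ∑ j ∈ Finset.Icc 1 (m q.2),
      A q (chebNode (m q.2) j) *
        (Lagrange.basis (Finset.Icc 1 (m q.2)) (chebNode (m q.2)) j).eval x)
      F (atTop ×ˢ atTop) (Set.Icc (-1) 1) := by
  have hK : 0 ≤ K := by simpa using (abs_nonneg _).trans (hG 0 1 0)
  set r : ℕ × ℕ → ℝ := fun q => 16 * (1 + Real.log (((m q.2 - 1 : ℕ) : ℝ) + 2)) *
    (C * (q.2 : ℝ) ^ (-(1 / 4) : ℝ) + K / Real.sqrt ((m q.2 - 1 : ℕ) : ℝ)) +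
      K / Real.sqrt ((m q.2 - 1 : ℕ) : ℝ) + K * |δ q| with hr
  have hm1 : Tendsto (fun N => m N - 1) atTop atTop := (tendsto_sub_atTop_nat 1).comp hm
  have hr0 : Tendsto r (atTop ×ˢ atTop) (𝓝 0) := by
    have t1 := (tendsto_log_mul_rpow_neg hmo).const_mul (16 * C)
    have t2 := (tendsto_one_add_log_mul_inv_sqrt.comp hm1).const_mul (16 * K)
    have t3 : Tendsto (fun N => K / Real.sqrt ((m N - 1 : ℕ) : ℝ)) atTop (𝓝 0) :=
      (tendsto_const_nhds (x := K)).div_atTop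
        (Real.tendsto_sqrt_atTop.comp (tendsto_natCast_atTop_atTop.comp hm1))
    have t4 := (((t1.add t2).add t3).comp (tendsto_snd (f := (atTop : Filter ℕ)))).add
      (hδ.abs.const_mul K)
    simp only [mul_zero, add_zero, abs_zero] at t4
    refine t4.congr' ?_
    filter_upwards [tendsto_snd.eventually (hm.eventually_ge_atTop 1)] with q hq
    have e : ((m q.2 - 1 : ℕ) : ℝ) + 2 = m q.2 + 1 := by
      rw [Nat.cast_sub hq]; push_cast; ring
    simp only [hr, Function.comp, e]
    ring
  rw [Metric.tendstoUniformlyOn_iff]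
  intro ε hε
  filter_upwards [hA, hGF (ε / 2) (by positivity), hr0.eventually_lt_const (half_pos hε),
    tendsto_snd.eventually (hm.eventually_ge_atTop 2)] with q hq1 hq2 hq3 hq4 x hx
  have h1 : |∑ j ∈ Finset.Icc 1 (m q.2), A q (chebNode (m q.2) j) *
      (Lagrange.basis (Finset.Icc 1 (m q.2)) (chebNode (m q.2)) j).eval x - G q (x - δ q)| ≤
      r q - K * |δ q| := by
    obtain ⟨M, hM⟩ : ∃ M, m q.2 = M + 1 := ⟨m q.2 - 1, by omega⟩
    have := abs_interpolation_sub_le (m := M) (g := fun x => G q (x - δ q))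
      (a := fun j => A q (chebNode (M + 1) j)) (ε := C * (q.2 : ℝ) ^ (-(1 / 4) : ℝ)) hK
      (fun x y => by simpa using hG q (x - δ q) (y - δ q)) (by omega)
      (fun j _ => hq1 _ ⟨Real.neg_one_le_cos _, Real.cos_le_one _⟩) hx
    simp only [hr, hM, Nat.add_sub_cancel, add_sub_cancel_right]
    exact this
  have h2 : |G q (x - δ q) - G q x| ≤ K * |δ q| := by
    refine (hG _ _ _).trans (le_of_eq ?_)
    rw [sub_sub_cancel_left, abs_neg]
  have h3 := hq2 x
  rw [Real.dist_eq, abs_sub_comm]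
  rw [abs_le] at h1 h2 h3
  rw [abs_lt]
  constructor <;> linarith [h1.1, h1.2, h2.1, h2.2, h3.1, h3.2]

/-! ### The observations -/

section Observations

variable {Ω : Type*} {σ γ : ℝ} {φ : ℕ → Ω → ℝ} {B BH : ℕ → ℝ≥0 → Ω → ℝ} {h : ℝ≥0}

lemma logObs_eq (ω : Ω) (i k : ℕ) : logObs σ γ φ B BH h ω i k =
    (φ i ω - σ ^ 2 / 2) * (k * (h : ℝ)) + mixedProcess σ γ (B i) (BH i) ((k : ℝ≥0) * h) ω := by
  rw [logObs, blackScholes, Real.log_exp]; push_cast; rfl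

/-- The trend estimation error of one subject is `meanIncr X 0 n ω / h`, and the error of `σ̂²`
shifts all the estimated effects alike. -/
lemma ecdfHat_logObs (hh : 0 < h) {n : ℕ} (hn : n ≠ 0) (N : ℕ) (ω : Ω) (x : ℝ) :
    ecdfHat h n N (logObs σ γ φ B BH h ω) x =
      ecdf N (fun i => φ i ω + meanIncr (fun k ω => mixedProcess σ γ (B i) (BH i)
        ((k : ℝ≥0) * h) ω) 0 n ω / h)
        (x - (sigmaSqHat h n N (logObs σ γ φ B BH h ω) - σ ^ 2) / 2) := by
  have hh' : (h : ℝ) ≠ 0 := by exact_mod_cast hh.ne'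
  rw [ecdfHat, ecdf]
  refine average_congr fun i _ => ?_
  rw [phiHat, thetaHat_eq (logObs_eq ω i) hh' hn]
  congr 1
  rw [eq_iff_iff, le_sub_iff_add_le]
  constructor <;> intro hx <;> linarith

end Observations

end MixedFBS

end

theorem theorem2 {Ω : Type*} [MeasurableSpace Ω] (P : Measure Ω) [IsProbabilityMeasure P]
    -- parameters and time step
    (σ γ H : ℝ) (hσ : 0 < σ) (hγ : 0 < γ) (hH : H ∈ Set.Ioo (1 / 2 : ℝ) 1)
    (h : ℝ≥0) (hh : 0 < h)
    -- driving noises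
    (B BH : ℕ → ℝ≥0 → Ω → ℝ)
    (hBmeas : ∀ i t, Measurable (B i t)) (hBHmeas : ∀ i t, Measurable (BH i t))
    (hB : ∀ i, IsBrownianReal (B i) P)
    (hBH : ∀ i, MixedFBS.IsFractionalBrownianMotion H (BH i) P)
    (hBBH : ∀ i, IndepFun (fun ω t => B i t ω) (fun ω t => BH i t ω) P)
    (hMindep : iIndepFun (fun i ω t => MixedFBS.mixedProcess σ γ (B i) (BH i) t ω) P)
    -- i.i.d. random effects in `[-1, 1]`, independent of the noises
    (φ : ℕ → Ω → ℝ) (hφmeas : ∀ i, Measurable (φ i))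
    (hφindep : iIndepFun φ P) (hφident : ∀ i, IdentDistrib (φ i) (φ 0) P P)
    (hφM : IndepFun (fun ω i => φ i ω)
      (fun ω i t => MixedFBS.mixedProcess σ γ (B i) (BH i) t ω) P)
    (hφsupp : ∀ i, ∀ᵐ ω ∂P, φ i ω ∈ Set.Icc (-1 : ℝ) 1)
    -- distribution function and density of the random effects
    (F f : ℝ → ℝ) (hF : F = fun x => cdf (P.map (φ 0)) x)
    (hfmeas : Measurable f) (hfnonneg : ∀ x, 0 ≤ f x)
    (hf : P.map (φ 0) = volume.withDensity fun x => ENNReal.ofReal (f x))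
    -- (A1)
    (hA1 : ∀ i, Integrable (fun ω => φ i ω ^ 4) P)
    -- (A2)
    (hA2 : ContDiffOn ℝ 2 F (Set.Icc (-1) 1))
    -- (A3)
    (hA3diff : DifferentiableOn ℝ f (Set.Icc (-1) 1))
    (hA3 : ∃ C : ℝ, ∀ x ∈ Set.Icc (-1 : ℝ) 1,
      |f x| ≤ C ∧ |derivWithin f (Set.Icc (-1) 1) x| ≤ C)
    -- number of nodes
    (m : ℕ → ℕ) (hm : Tendsto m atTop atTop)
    (hmo : (fun N : ℕ => (m N : ℝ)) =o[atTop] fun N : ℕ => Real.sqrt N / Real.log N) :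
    ∀ᵐ ω ∂P, TendstoUniformlyOn
      (fun (p : ℕ × ℕ) (x : ℝ) => MixedFBS.lagrangeEstimator h (m p.2) p.1 p.2
        (MixedFBS.logObs σ γ φ B BH h ω) x)
      F (atTop ×ˢ atTop) (Set.Icc (-1) 1) := by
  obtain ⟨K, hKf⟩ := hA3
  have hh' : (0 : ℝ) < h := by exact_mod_cast hh
  have := Measure.isProbabilityMeasure_map (μ := P) (hφmeas 0).aemeasurable
  set μ := P.map (φ 0) with hμ
  have hK : ∀ x y, |cdf μ x - cdf μ y| ≤ K * |x - y| :=
    MixedFBS.cdf_lipschitz hf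
      ((ae_map_iff (hφmeas 0).aemeasurable measurableSet_Icc).2 (hφsupp 0)) fun x hx => (hKf x hx).1
  -- the noise of subject `i` at the observation times, and the errors of the trend estimators
  set X : ℕ → ℕ → Ω → ℝ := fun i k ω =>
    MixedFBS.mixedProcess σ γ (B i) (BH i) ((k : ℝ≥0) * h) ω with hXdef
  set T : ℕ → ℕ → Ω → ℝ := fun i n ω => MixedFBS.meanIncr (X i) 0 n ω / h with hTdef
  have hX : ∀ i, MixedFBS.IsMixedNoise (σ ^ 2 * h) (γ ^ 2 * (h : ℝ) ^ (2 * H)) H (X i) P :=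
    fun i => MixedFBS.isMixedNoise_mixedProcess h (hB i) (hBH i) (hBBH i)
  have h₁ : 0 ≤ σ ^ 2 * (h : ℝ) := by positivity
  have h₂ : 0 ≤ γ ^ 2 * (h : ℝ) ^ (2 * H) := by positivity
  have hXm : ∀ i k, Measurable (X i k) := fun i k =>
    ((hBmeas i _).const_mul σ).add ((hBHmeas i _).const_mul γ)
  have hsample : Measurable fun (x : ℝ≥0 → ℝ) (k : ℕ) => x ((k : ℝ≥0) * h) :=
    measurable_pi_lambda _ fun k => measurable_pi_apply _
  have hXind : iIndepFun (fun i ω k => X i k ω) P :=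
    hMindep.comp (fun _ x (k : ℕ) => x ((k : ℝ≥0) * h)) fun _ => hsample
  have hφX : IndepFun (fun ω i => φ i ω) (fun ω i k => X i k ω) P :=
    hφM.comp (φ := id) (ψ := fun (x : ℕ → ℝ≥0 → ℝ) i (k : ℕ) => x i ((k : ℝ≥0) * h)) measurable_id
      (measurable_pi_lambda _ fun i => hsample.comp (measurable_pi_apply i))
  have hpair : iIndepFun (fun i ω => (φ i ω, fun k => X i k ω)) P :=
    MixedFBS.iIndepFun_prodMk hφmeas (fun i => measurable_pi_lambda _ fun k => hXm i k)
      hφindep hXind hφX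
  have hg : ∀ n, Measurable fun x : ℕ → ℝ => (x (0 + 0 + n) - x (0 + 0)) / n / (h : ℝ) :=
    fun n => by fun_prop
  have hTm : ∀ i n, Measurable (T i n) := fun i n =>
    (hg n).comp (measurable_pi_lambda _ fun k => hXm i k)
  have hZind : ∀ n, iIndepFun (fun i ω => φ i ω + T i n ω) P := fun n =>
    hpair.comp (fun _ q => q.1 + (q.2 (0 + 0 + n) - q.2 (0 + 0)) / n / (h : ℝ))
      fun _ => measurable_fst.add ((hg n).comp measurable_snd)
  have hφT : ∀ i n, IndepFun (φ i) (T i n) P := fun i n =>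
    hφX.comp (measurable_pi_apply i) ((hg n).comp (measurable_pi_apply i))
  have hTint : ∀ i n p, Integrable (fun ω => T i n ω ^ p) P := by
    intro i n p
    simp only [hTdef, MixedFBS.meanIncr, div_pow]
    exact ((MixedFBS.integrable_pow_of_hasGaussianLaw ((hX i).hasGaussianLaw_incr n 0 0)
      p).div_const _).div_const _
  set C : ℕ → ℝ := fun p => (σ ^ 2 * h + γ ^ 2 * (h : ℝ) ^ (2 * H)) ^ p *
    MixedFBS.stdMoment (2 * p) / (h : ℝ) ^ (2 * p) with hC
  have hC0 : ∀ p, 0 ≤ C p := by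
    intro p
    have : 0 ≤ MixedFBS.stdMoment (2 * p) := integral_nonneg fun x => by
      simp only [pow_mul]; positivity
    positivity
  have hTmom : ∀ i n p, ∫ ω, T i n ω ^ (2 * p) ∂P ≤ C p * (n : ℝ) ^ (-(p * (2 - 2 * H))) := by
    intro i n p
    have h1 := MixedFBS.integral_incr_div_pow_le (hX i) hH.1 h₁ h₂ 0 p n
    simp only [hTdef, MixedFBS.meanIncr]
    simp_rw [div_pow _ (h : ℝ)]
    rw [integral_div, hC, div_mul_eq_mul_div, ← mul_neg, neg_sub]
    exact div_le_div_of_nonneg_right h1 (by positivity)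
  obtain ⟨G, hG, hGF, hae⟩ := MixedFBS.exists_lipschitz_approx_ecdf hφmeas hTm hφindep hZind hφT
    (fun i => (hφident i).map_eq) hK (by linarith [hH.2] : 0 < 2 - 2 * H) hC0 hTint hTmom
  filter_upwards [hae, ae_all_iff.2 hφsupp,
    ae_all_iff.2 fun r => ae_all_iff.2 fun s =>
      MixedFBS.ae_tendsto_average_incr_sq hX hXind hH h₁ h₂ r s,
    ae_all_iff.2 fun s =>
      MixedFBS.ae_tendsto_average_sq_mean_incr hX hXind hH h₁ h₂ s] with ω hω hsupp hq ht
  have hσhat := MixedFBS.tendsto_sigmaSqHat (A := 1 + σ ^ 2 / 2) hh' hγ hH.1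
    (fun i => by
      have := hsupp i
      have := sq_nonneg σ
      rw [abs_le]; constructor <;> linarith [(hsupp i).1, (hsupp i).2])
    (MixedFBS.logObs_eq (σ := σ) (γ := γ) (φ := φ) (B := B) (BH := BH) ω) hq ht
  have hδ := (hσhat.sub_const (σ ^ 2)).div_const 2
  rw [sub_self, zero_div] at hδ
  rw [hF]
  refine MixedFBS.tendstoUniformlyOn_interpolation hm hmo hG hGF hδ (C := 1 + 2 * K) ?_
  have hδ1 : ∀ᶠ q : ℕ × ℕ in atTop ×ˢ atTop,
      |(MixedFBS.sigmaSqHat h q.1 q.2 (MixedFBS.logObs σ γ φ B BH h ω) - σ ^ 2) / 2| < 1 := by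
    have := hδ.abs
    rw [abs_zero] at this
    exact this.eventually_lt_const one_pos
  filter_upwards [hω, hδ1, tendsto_fst.eventually_ne_atTop 0] with q q1 q2 hn y hy
  rw [MixedFBS.ecdfHat_logObs hh hn]
  refine q1 _ ?_
  rw [abs_lt] at q2
  rw [abs_le]
  constructor <;> linarith [hy.1, hy.2, q2.1, q2.2]
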